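/- Let $M$ be a smooth (finite-dimensional, Hausdorff) manifold, let $\omega$ be a pre-symplectic form on $M$ (a closed, possibly degenerate, $2$-form), and let $\mathfrak g$ be a real Lie algebra acting on $(M,\omega)$ by symplectomorphisms, i.e. we are given a Lie algebra morphism $a\colon\mathfrak g\to\mathfrak X(M)$ with $L_{a(x)}\omega=0$ for all $x\in\mathfrak g$. Conventions. $\iota_X\omega=\omega(X,\cdot)$ and $\iota_{X\wedge Y}\omega=\iota_X\iota_Y\omega=\omega(Y,X)$. A function $f$ is Hamiltonian if there is a vector field $X_f$ with $\iota_{X_f}\omega=df$; the Hamiltonian functions form a Lie algebra under $\{f,g\}=\iota_{X_f\wedge X_g}\omega=X_f(g)$. $L_\infty$-algebras are graded real vector spaces concentrated in positive degrees with graded symmetric brackets $l_n$ of degree $-1$ satisfying $\sum_{i+j=n+1}l_j\circ l_i=0$ (insertion summed over unshuffles with Koszul signs) for all $n$; $L_\infty$-morphisms have graded symmetric components of degree $0$ and satisfy the usual compatibility equations. A Lie algebra is an $L_\infty$-algebra concentrated in degree $1$ with only the bracket $l_2=[-,-]$. Let $\widetilde\Xi(M)$ be the $L_\infty$-algebra of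 Hamiltonian pairs $(X,f)$, $\iota_X\omega=df$, concentrated in degree $1$, with $l_2\big((X,f),(Y,g)\big)=([X,Y],\iota_{X\wedge Y}\omega)$ and $l_n=0$ for $n\ne2$, and $\pi(X,f)=X$. The degree-$1$ truncation $\mathfrak X(M)$ of the multivector fields carries two $L_\infty$-structures: the one given by the Lie (Schouten) bracket $\nu_2$ only, and the one given by the degree-$1$ components of all the brackets $\nu_n(X_1,\dots,X_n)=\sum_{\sigma\in Sh(2,n-2)}\varepsilon(\sigma)\,[X_{\sigma(1)},X_{\sigma(2)}]\wedge X_{\sigma(3)}\wedge\dots\wedge X_{\sigma(n)}$; the action $a$ defines an $L_\infty$-morphism with only component $a_1=a$ from $\mathfrak g$ to the first (the $L_\infty$-action) and to the second (the strong $L_\infty$-action). Let $C(\mathfrak g)$ be the shifted and truncated Chevalley–Eilenberg complex $\Lambda^2\mathfrak g\to\mathfrak g$, $e(x\wedge y)=[x,y]$, in degrees $0,1$, let $\mathrm{tr}_1\Omega^\bullet(M)$ be the complex $d\colon C^\infty(M)\to\Omega^1(M)$ in degrees $0,1$, and let $\mathsf f\colon C(\mathfrak g)\to\mathrm{tr}_1\Omega^\bullet(M)$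 be the cochain map $\mathsf f(x\wedge y)=\iota_{a(x)\wedge a(y)}\omega$, $\mathsf f(x)=\iota_{a(x)}\omega$. Then the following five kinds of objects are in one-to-one correspondence: 1. co-momentum maps: Lie algebra morphisms $\mu$ from $\mathfrak g$ to the Hamiltonian functions with $\iota_{a(x)}\omega=d\mu(x)$ for all $x\in\mathfrak g$; 2. $L_\infty$-momentum maps: $L_\infty$-morphisms $\tilde h\colon\mathfrak g\to\widetilde\Xi(M)$ which lift the $L_\infty$-action along $\pi$; 3. strong $L_\infty$-momentum maps: $L_\infty$-morphisms $\tilde h\colon\mathfrak g\to\widetilde\Xi(M)$ which lift, component by component, the strong $L_\infty$-action along $\pi$; 4. homotopy momentum maps: linear maps $\mathsf h\colon C(\mathfrak g)\to\mathrm{tr}_1\Omega^\bullet(M)$ of degree $-1$ with $\mathsf f=\mathsf h\circ e+d\circ\mathsf h$; 5. homotopy Hamiltonian momentum maps: homotopy momentum maps $\mathsf h$ with $(\mathsf h\circ l_1)(\mathfrak g)=0$, where $l_1$ is the unary bracket of $\mathfrak g$. More precisely, there are bijections from the set of co-momentum maps to each of the other four sets under which $\mu$ corresponds to the objects with $\tilde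 h_1(x)=(a(x),\mu(x))$, respectively $\mathsf h(x)=\mu(x)$, for all $x\in\mathfrak g$. -/

import Mathlib

open scoped Manifold Bundle

set_option linter.unusedSectionVars false

noncomputable section

namespace MomentumMaps

/-! ## L-infinity algebras

We use the convention in which the brackets are graded symmetric of degree `-1`, the underlying
graded vector space being concentrated in positive degrees.  A graded vector space is given
internally, by a family of submodules of its total space. -/

section LInfty

/-- The Koszul sign `ε(σ)` of the reordering `x_{σ 0} ⊗ x_{σ 1} ⊗ ⋯` of a list of homogeneous
elements `x_i` of degrees `d i`: one factor `(-1)^{|x||y|}` for each inversion. -/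
def koszulSign {n : ℕ} (d : Fin n → ℤ) (σ : Equiv.Perm (Fin n)) : ℤ :=
  ∏ a, ∏ b, if a < b ∧ σ b < σ a then ((d (σ a) * d (σ b)).negOnePow : ℤ) else 1

/-- `σ` is a `(p, n - p)`-unshuffle: it is increasing on the first `p` indices and on the others. -/
def IsUnshuffle {n : ℕ} (p : ℕ) (σ : Equiv.Perm (Fin n)) : Prop :=
  ∀ a b : Fin n, a < b → (b.val < p ∨ p ≤ a.val) → σ a < σ b

instance {n : ℕ} (p : ℕ) : DecidablePred (IsUnshuffle (n := n) p) := fun σ =>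
  inferInstanceAs (Decidable (∀ a b : Fin n, a < b → (b.val < p ∨ p ≤ a.val) → σ a < σ b))

/-- `σ` is a `(p₁, …, p_q)`-unshuffle, where `(p₁, …, p_q)` is the composition `c` of `n`:
it is increasing on each block of `c`. -/
def IsBlockUnshuffle {n : ℕ} (c : Composition n) (σ : Equiv.Perm (Fin n)) : Prop :=
  ∀ (a : Fin c.length) (b b' : Fin (c.blocksFun a)), b < b' →
    σ (c.embedding a b) < σ (c.embedding a b')

instance {n : ℕ} (c : Composition n) : DecidablePred (IsBlockUnshuffle c) := fun σ =>
  inferInstanceAs (Decidable (∀ (a : Fin c.length) (b b' : Fin (c.blocksFun a)), b < b' →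
    σ (c.embedding a b) < σ (c.embedding a b')))

variable {V W : Type*} [AddCommGroup V] [Module ℝ V] [AddCommGroup W] [Module ℝ W]

/-- The insertion `∑_{i + j = n + 1} f_j ⌐ l_i` of the brackets `l` into the maps `f`, evaluated at
homogeneous elements `x` of degrees `d`:
`∑_{i + j = n + 1} ∑_{σ ∈ Sh(i, n - i)} ε(σ) f_j (l_i (x_{σ 1}, …, x_{σ i}), x_{σ (i+1)}, …)`.
The summation index `i : Fin n` stands for the arity `i + 1` of the inner bracket. -/
def insertion (f : ∀ n : ℕ, MultilinearMap ℝ (fun _ : Fin n => V) W)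
    (l : ∀ n : ℕ, MultilinearMap ℝ (fun _ : Fin n => V) V)
    {n : ℕ} (d : Fin n → ℤ) (x : Fin n → V) : W :=
  ∑ i : Fin n, ∑ σ : Equiv.Perm (Fin n) with IsUnshuffle (i.val + 1) σ,
    koszulSign d σ • f (n - (i.val + 1) + 1)
      (Fin.cons (l (i.val + 1) fun k => x (σ ⟨k.val, by omega⟩))
        fun k => x (σ ⟨i.val + 1 + k.val, by omega⟩))

variable (V) in
/-- An L-infinity algebra concentrated in positive degrees with total space `V`. -/
@[ext]
structure LInftyAlgebra where
  /-- the homogeneous component of each degree -/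
  gr : ℤ → Submodule ℝ V
  isInternal : DirectSum.IsInternal gr
  pos : ∀ k ≤ 0, gr k = ⊥
  /-- the brackets -/
  l : ∀ n : ℕ, MultilinearMap ℝ (fun _ : Fin n => V) V
  l_degree : ∀ (n : ℕ) (d : Fin n → ℤ) (x : Fin n → V), (∀ i, x i ∈ gr (d i)) →
    l n x ∈ gr (∑ i, d i - 1)
  l_symm : ∀ (n : ℕ) (d : Fin n → ℤ) (x : Fin n → V), (∀ i, x i ∈ gr (d i)) →
    ∀ σ : Equiv.Perm (Fin n), l n x = koszulSign d σ • l n (fun i => x (σ i))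
  jacobi : ∀ (n : ℕ) (d : Fin n → ℤ) (x : Fin n → V), (∀ i, x i ∈ gr (d i)) →
    insertion l l d x = 0

/-- An L-infinity morphism: a family of graded symmetric multilinear maps `f n` of degree `0` with
`∑_{i+j=n+1} (f_j ⌐ l_i)(x)
  = ∑_{p₁+⋯+p_q=n} ∑_{σ ∈ Sh(p₁,…,p_q)} 1/q! ε(σ) v_q (f_{p₁} ⊗ ⋯ ⊗ f_{p_q}) (x_{σ 1}, …, x_{σ n})`. -/
@[ext]
structure LInftyMorphism (A : LInftyAlgebra V) (B : LInftyAlgebra W) where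
  /-- the components of the morphism -/
  f : ∀ n : ℕ, MultilinearMap ℝ (fun _ : Fin n => V) W
  f_degree : ∀ (n : ℕ) (d : Fin n → ℤ) (x : Fin n → V), (∀ i, x i ∈ A.gr (d i)) →
    f n x ∈ B.gr (∑ i, d i)
  f_symm : ∀ (n : ℕ) (d : Fin n → ℤ) (x : Fin n → V), (∀ i, x i ∈ A.gr (d i)) →
    ∀ σ : Equiv.Perm (Fin n), f n x = koszulSign d σ • f n (fun i => x (σ i))
  compat : ∀ (n : ℕ) (d : Fin n → ℤ) (x : Fin n → V), (∀ i, x i ∈ A.gr (d i)) →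
    insertion f A.l d x =
      ∑ c : Composition n, ∑ σ : Equiv.Perm (Fin n) with IsBlockUnshuffle c σ,
        ((c.length.factorial : ℝ)⁻¹) • koszulSign d σ •
          B.l c.length fun a => f (c.blocksFun a) fun b => x (σ (c.embedding a b))

/-! ### Lie algebras as L-infinity algebras -/

variable (V) in
/-- The grading of `V` concentrated in degree one. -/
def degreeOne (k : ℤ) : Submodule ℝ V := if k = 1 then ⊤ else ⊥

theorem degreeOne_isInternal : DirectSum.IsInternal (degreeOne V) := by
  rw [DirectSum.isInternal_submodule_iff_iSupIndep_and_iSup_eq_top]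
  constructor
  · intro i
    by_cases hi : i = 1
    · have : (⨆ j, ⨆ (_ : j ≠ i), degreeOne V j) = ⊥ := by
        simp only [iSup_eq_bot]
        intro j hj
        simp [degreeOne, hi ▸ hj]
      rw [this]; exact disjoint_bot_right
    · simp [degreeOne, hi]
  · refine eq_top_iff.2 (le_trans ?_ (le_iSup (degreeOne V) 1))
    simp [degreeOne]

theorem eq_zero_of_mem_degreeOne {k : ℤ} {v : V} (hv : v ∈ degreeOne V k) (hk : k ≠ 1) :
    v = 0 := by
  simpa [degreeOne, hk] using hv

variable (L : Type*) [LieRing L] [LieAlgebra ℝ L] {L' : Type*} [LieRing L'] [LieAlgebra ℝ L']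

/-- The Lie bracket as an alternating map. -/
def lieBracketAlt : L [⋀^Fin 2]→ₗ[ℝ] L where
  toFun v := ⁅v 0, v 1⁆
  map_update_add' := by
    intro _ v i x y
    fin_cases i <;> simp
  map_update_smul' := by
    intro _ v i c x
    fin_cases i <;> simp
  map_eq_zero_of_eq' := by
    intro v i j hij hne
    fin_cases i <;> fin_cases j <;> simp_all

/-- The brackets of the L-infinity algebra of a Lie algebra: the binary bracket is the Lie bracket,
all the others vanish. -/
def lieBrackets : ∀ n : ℕ, MultilinearMap ℝ (fun _ : Fin n => L) L
  | 2 => (lieBracketAlt L).toMultilinearMap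
  | _ => 0

variable {L}

@[simp]
theorem lieBrackets_two (v : Fin 2 → L) : lieBrackets L 2 v = ⁅v 0, v 1⁆ := rfl

theorem lieBrackets_apply {n : ℕ} (hn : n = 2) (v : Fin n → L) :
    lieBrackets L n v = ⁅v ⟨0, by omega⟩, v ⟨1, by omega⟩⁆ := by
  subst hn; rfl

theorem lieBrackets_of_ne {n : ℕ} (hn : n ≠ 2) : lieBrackets L n = 0 := by
  unfold lieBrackets
  split
  · exact absurd rfl hn
  · rfl

theorem koszulSign_of_one {n : ℕ} {d : Fin n → ℤ} (hd : ∀ i, d i = 1) (σ : Equiv.Perm (Fin n)) :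
    koszulSign d σ = ∏ a, ∏ b, if a < b ∧ σ b < σ a then -1 else 1 := by
  simp [koszulSign, hd]

theorem eq_zero_or_degree_one {n : ℕ} {d : Fin n → ℤ} {x : Fin n → V}
    (hx : ∀ i, x i ∈ degreeOne V (d i)) : (∃ i, x i = 0) ∨ ∀ i, d i = 1 := by
  by_cases h : ∀ i, d i = 1
  · exact Or.inr h
  · push Not at h
    obtain ⟨i, hi⟩ := h
    exact Or.inl ⟨i, eq_zero_of_mem_degreeOne (hx i) hi⟩

theorem lieBrackets_insertion (n : ℕ) (d : Fin n → ℤ) (x : Fin n → L)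
    (hx : ∀ i, x i ∈ degreeOne L (d i)) :
    insertion (lieBrackets L) (lieBrackets L) d x = 0 := by
  by_cases hn : n = 3
  · subst hn
    have hS : (Finset.univ.filter fun σ : Equiv.Perm (Fin 3) => IsUnshuffle 2 σ) =
        {1, Equiv.swap 1 2, finRotate 3} := by decide
    unfold insertion
    rw [Finset.sum_eq_single (1 : Fin 3)]
    · change ∑ σ ∈ Finset.univ.filter (fun σ : Equiv.Perm (Fin 3) => IsUnshuffle 2 σ),
        koszulSign d σ • ⁅⁅x (σ 0), x (σ 1)⁆, x (σ 2)⁆ = 0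
      rw [hS]
      rcases eq_zero_or_degree_one hx with ⟨i, hi⟩ | hd
      · refine Finset.sum_eq_zero fun σ _ => ?_
        obtain ⟨j, rfl⟩ := σ.surjective i
        fin_cases j <;> simp_all
      · have h1 : koszulSign d 1 = 1 := by rw [koszulSign_of_one hd]; decide
        have h2 : koszulSign d (Equiv.swap 1 2) = -1 := by rw [koszulSign_of_one hd]; decide
        have h3 : koszulSign d (finRotate 3) = 1 := by rw [koszulSign_of_one hd]; decide
        rw [Finset.sum_insert (by decide), Finset.sum_insert (by decide), Finset.sum_singleton,
          h1, h2, h3]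
        have e1 : (Equiv.swap 1 2 : Equiv.Perm (Fin 3)) 0 = 0 := by decide
        have e2 : (Equiv.swap 1 2 : Equiv.Perm (Fin 3)) 1 = 2 := by decide
        have e3 : (Equiv.swap 1 2 : Equiv.Perm (Fin 3)) 2 = 1 := by decide
        have e4 : finRotate 3 0 = 1 := by decide
        have e5 : finRotate 3 1 = 2 := by decide
        have e6 : finRotate 3 2 = 0 := by decide
        simp only [e1, e2, e3, e4, e5, e6, Equiv.Perm.coe_one, id_eq, one_smul, neg_smul]
        have := lie_jacobi (x 0) (x 1) (x 2)
        rw [← lie_skew ⁅x 0, x 1⁆, ← lie_skew ⁅x 0, x 2⁆, ← lie_skew ⁅x 1, x 2⁆,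
          ← lie_skew (x 0) (x 2), lie_neg]
        rw [← neg_eq_zero, ← this]
        abel
    · intro b _ hb
      refine Finset.sum_eq_zero fun σ _ => ?_
      have hb' : b.val + 1 ≠ 2 := fun h => hb (Fin.ext (by simpa using h))
      rw [lieBrackets_of_ne hb']
      convert smul_zero _
      exact MultilinearMap.map_coord_zero _ 0 (by simp)
    · simp
  · refine Finset.sum_eq_zero fun i _ => Finset.sum_eq_zero fun σ _ => ?_
    by_cases hi : i.val + 1 = 2
    · rw [lieBrackets_of_ne (n := n - (i.val + 1) + 1) (by omega)]
      simp
    · rw [lieBrackets_of_ne hi]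
      convert smul_zero _
      exact MultilinearMap.map_coord_zero _ 0 (by simp)

variable (L) in
/-- A Lie algebra, placed in degree one, as an L-infinity algebra. -/
def LInftyAlgebra.ofLie : LInftyAlgebra L where
  gr := degreeOne L
  isInternal := degreeOne_isInternal
  pos k hk := by simp [degreeOne, show k ≠ 1 by omega]
  l := lieBrackets L
  l_degree n d x hx := by
    by_cases hn : n = 2
    · subst hn
      rcases eq_zero_or_degree_one hx with ⟨i, hi⟩ | hd
      · rw [MultilinearMap.map_coord_zero _ i hi]
        exact zero_mem _
      · simp [hd, degreeOne]
    · simp [lieBrackets_of_ne hn]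
  l_symm n d x hx σ := by
    by_cases hn : n = 2
    · subst hn
      rcases eq_zero_or_degree_one hx with ⟨i, hi⟩ | hd
      · obtain ⟨j, rfl⟩ := σ.surjective i
        rw [MultilinearMap.map_coord_zero _ _ hi, MultilinearMap.map_coord_zero _ j hi, smul_zero]
      · have hσ : σ = 1 ∨ σ = Equiv.swap 0 1 := by revert σ; decide
        rw [koszulSign_of_one hd]
        rcases hσ with rfl | rfl
        · simp
        · simp [Fin.prod_univ_two]
    · simp [lieBrackets_of_ne hn]
  jacobi := lieBrackets_insertion

variable {B : LInftyAlgebra L'}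

/-- The components of the strict morphism given by a linear map. -/
def strictComponents (φ : V →ₗ[ℝ] W) : ∀ n : ℕ, MultilinearMap ℝ (fun _ : Fin n => V) W
  | 1 => φ.compMultilinearMap (MultilinearMap.ofSubsingleton ℝ V V (0 : Fin 1) LinearMap.id)
  | _ => 0

@[simp]
theorem strictComponents_one (φ : V →ₗ[ℝ] W) (v : Fin 1 → V) :
    strictComponents φ 1 v = φ (v 0) := rfl

theorem strictComponents_apply (φ : V →ₗ[ℝ] W) {n : ℕ} (hn : n = 1) (v : Fin n → V) :
    strictComponents φ n v = φ (v ⟨0, by omega⟩) := by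
  subst hn; rfl

theorem strictComponents_of_ne (φ : V →ₗ[ℝ] W) {n : ℕ} (hn : n ≠ 1) :
    strictComponents φ n = 0 := by
  unfold strictComponents
  split
  · exact absurd rfl hn
  · rfl

/-- A morphism of Lie algebras, as an L-infinity morphism with vanishing higher components. -/
def LInftyMorphism.ofLieHom (hB : B = LInftyAlgebra.ofLie L') (φ : L →ₗ⁅ℝ⁆ L') :
    LInftyMorphism (LInftyAlgebra.ofLie L) B where
  f := strictComponents (φ : L →ₗ[ℝ] L')
  f_degree n d x hx := by
    subst hB
    by_cases hn : n = 1
    · subst hn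
      rcases eq_zero_or_degree_one hx with ⟨i, hi⟩ | hd
      · rw [MultilinearMap.map_coord_zero _ i hi]
        exact zero_mem _
      · simp [hd, LInftyAlgebra.ofLie, degreeOne]
    · simp [strictComponents_of_ne _ hn]
  f_symm n d x hx σ := by
    by_cases hn : n = 1
    · subst hn
      have hσ : σ = 1 := Subsingleton.elim _ _
      simp [hσ, koszulSign]
    · simp [strictComponents_of_ne _ hn]
  compat n d x hx := by
    subst hB
    by_cases hn : n = 2
    · subst hn
      have hS : (Finset.univ.filter fun σ : Equiv.Perm (Fin 2) => IsUnshuffle 2 σ) = {1} := by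
        decide
      have hl : insertion (strictComponents (φ : L →ₗ[ℝ] L')) (lieBrackets L) d x =
          φ ⁅x 0, x 1⁆ := by
        unfold insertion
        rw [Finset.sum_eq_single (1 : Fin 2)]
        · change ∑ σ ∈ Finset.univ.filter (fun σ : Equiv.Perm (Fin 2) => IsUnshuffle 2 σ),
            koszulSign d σ • φ ⁅x (σ 0), x (σ 1)⁆ = _
          rw [hS]
          simp [koszulSign]
        · intro b _ hb
          refine Finset.sum_eq_zero fun σ _ => ?_
          have hb' : b.val + 1 ≠ 2 := fun h => hb (Fin.ext (by simpa using h))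
          rw [lieBrackets_of_ne hb']
          convert smul_zero _
          exact MultilinearMap.map_coord_zero _ 0 (by simp)
        · simp
      refine hl.trans ?_
      have hunit : ∀ a, (Composition.ones 2).blocksFun a = 1 := fun a =>
        Composition.ones_blocksFun 2 a
      have hlen : (Composition.ones 2).length = 2 := Composition.ones_length 2
      rw [Finset.sum_eq_single (Composition.ones 2)]
      · rw [Finset.filter_true_of_mem]
        · have hU : (Finset.univ : Finset (Equiv.Perm (Fin 2))) = {1, Equiv.swap 0 1} := by decide
          have hterm : ∀ σ : Equiv.Perm (Fin 2), (LInftyAlgebra.ofLie L').l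
              (Composition.ones 2).length (fun a => strictComponents (φ : L →ₗ[ℝ] L')
                ((Composition.ones 2).blocksFun a)
                fun b => x (σ ((Composition.ones 2).embedding a b))) =
              ⁅φ (x (σ 0)), φ (x (σ 1))⁆ := by
            intro σ
            refine (lieBrackets_apply hlen _).trans ?_
            rw [strictComponents_apply _ (hunit _), strictComponents_apply _ (hunit _),
              Composition.ones_embedding, Composition.ones_embedding]
            rfl
          simp only [hterm]
          rw [hU, Finset.sum_pair (by decide), hlen]
          rcases eq_zero_or_degree_one hx with ⟨i, hi⟩ | hd
          · fin_cases i <;> simp_all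
          · have h1 : koszulSign d 1 = 1 := by rw [koszulSign_of_one hd]; decide
            have h2 : koszulSign d (Equiv.swap 0 1) = -1 := by rw [koszulSign_of_one hd]; decide
            rw [h1, h2]
            simp only [Equiv.Perm.coe_one, id_eq, Equiv.swap_apply_left, Equiv.swap_apply_right,
              one_smul, neg_smul, LieHom.map_lie]
            rw [lie_skew, ← two_smul ℝ, ← mul_smul]
            norm_num
        · intro σ _ a b b' hbb'
          have := hunit a
          omega
      · intro c _ hc
        have hc' : c.length ≠ 2 := fun h => hc (Composition.eq_ones_iff_length.2 h)
        refine Finset.sum_eq_zero fun σ _ => ?_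
        change _ • _ • lieBrackets L' c.length _ = 0
        rw [lieBrackets_of_ne hc']
        simp
      · simp
    · have hl : insertion (strictComponents (φ : L →ₗ[ℝ] L')) (lieBrackets L) d x = 0 := by
        refine Finset.sum_eq_zero fun i _ => Finset.sum_eq_zero fun σ _ => ?_
        by_cases hi : i.val + 1 = 2
        · rw [strictComponents_of_ne (n := n - (i.val + 1) + 1) _ (by omega)]
          simp
        · rw [lieBrackets_of_ne hi]
          convert smul_zero _
          exact MultilinearMap.map_coord_zero _ 0 (by simp)
      refine hl.trans (Eq.symm ?_)
      refine Finset.sum_eq_zero fun c _ => Finset.sum_eq_zero fun σ _ => ?_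
      change _ • _ • lieBrackets L' c.length _ = 0
      by_cases hc : c.length = 2
      · have hex : ∃ a, c.blocksFun a ≠ 1 := by
          by_contra! hcon
          have := c.sum_blocksFun
          simp only [hcon, Finset.sum_const, Finset.card_univ, Fintype.card_fin, smul_eq_mul,
            mul_one] at this
          omega
        obtain ⟨a, ha⟩ := hex
        rw [MultilinearMap.map_coord_zero _ a (by rw [strictComponents_of_ne _ ha]; rfl)]
        simp
      · rw [lieBrackets_of_ne hc]
        simp

end LInfty

/-! ## Cochain complexes and null-homotopies -/

section Cochain

variable {V W : Type*} [AddCommGroup V] [Module ℝ V] [AddCommGroup W] [Module ℝ W]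

variable (V) in
/-- A cochain complex of real vector spaces with total space `V`. -/
structure CochainCx where
  /-- the homogeneous component of each degree -/
  gr : ℤ → Submodule ℝ V
  isInternal : DirectSum.IsInternal gr
  /-- the differential -/
  d : V →ₗ[ℝ] V
  d_degree : ∀ (k : ℤ) (v : V), v ∈ gr k → d v ∈ gr (k + 1)
  d_d : ∀ v, d (d v) = 0

/-- A cochain map: a linear map of degree `0` commuting with the differentials. -/
structure CochainMap (C : CochainCx V) (D : CochainCx W) where
  /-- the underlying linear map -/
  toLinearMap : V →ₗ[ℝ] W
  map_degree : ∀ (k : ℤ) (v : V), v ∈ C.gr k → toLinearMap v ∈ D.gr k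
  map_d : ∀ v, toLinearMap (C.d v) = D.d (toLinearMap v)

/-- A cochain null-homotopy of `f`: a linear map `h` of degree `-1` with `f = h ∘ d + d ∘ h`. -/
@[ext]
structure CochainNullHomotopy {C : CochainCx V} {D : CochainCx W} (f : CochainMap C D) where
  /-- the homotopy -/
  h : V →ₗ[ℝ] W
  h_degree : ∀ (k : ℤ) (v : V), v ∈ C.gr k → h v ∈ D.gr (k - 1)
  eq : ∀ v, f.toLinearMap v = h (C.d v) + D.d (h v)

/-- The composition of cochain maps. -/
def CochainMap.comp {U : Type*} [AddCommGroup U] [Module ℝ U] {A : CochainCx U} {B : CochainCx V}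
    {C : CochainCx W} (φ : CochainMap B C) (ψ : CochainMap A B) : CochainMap A C where
  toLinearMap := φ.toLinearMap ∘ₗ ψ.toLinearMap
  map_degree k v hv := φ.map_degree k _ (ψ.map_degree k v hv)
  map_d v := by simp [φ.map_d, ψ.map_d]

variable (V W) in
/-- The grading of `V × W` with `V` in degree `0` and `W` in degree `1`. -/
def twoTerm (k : ℤ) : Submodule ℝ (V × W) :=
  if k = 0 then LinearMap.range (LinearMap.inl ℝ V W)
  else if k = 1 then LinearMap.range (LinearMap.inr ℝ V W) else ⊥

theorem mem_twoTerm_zero {v : V × W} : v ∈ twoTerm V W 0 ↔ v.2 = 0 := by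
  obtain ⟨a, b⟩ := v
  simp [twoTerm, eq_comm]

theorem mem_twoTerm_one {v : V × W} : v ∈ twoTerm V W 1 ↔ v.1 = 0 := by
  obtain ⟨a, b⟩ := v
  simp [twoTerm, eq_comm]

theorem mem_twoTerm_of_ne {k : ℤ} (h0 : k ≠ 0) (h1 : k ≠ 1) {v : V × W} :
    v ∈ twoTerm V W k ↔ v = 0 := by
  simp [twoTerm, h0, h1]

theorem twoTerm_isInternal : DirectSum.IsInternal (twoTerm V W) := by
  rw [DirectSum.isInternal_submodule_iff_iSupIndep_and_iSup_eq_top]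
  constructor
  · intro i
    by_cases h0 : i = 0
    · subst h0
      have : (⨆ j, ⨆ (_ : j ≠ 0), twoTerm V W j) ≤ twoTerm V W 1 := by
        refine iSup₂_le fun j hj => ?_
        by_cases h1 : j = 1
        · rw [h1]
        · intro v hv
          rw [(mem_twoTerm_of_ne hj h1).1 hv]
          exact zero_mem _
      refine Disjoint.mono_right this ?_
      rw [Submodule.disjoint_def]
      intro v hv hv'
      exact Prod.ext (mem_twoTerm_one.1 hv') (mem_twoTerm_zero.1 hv)
    · by_cases h1 : i = 1
      · subst h1
        have : (⨆ j, ⨆ (_ : j ≠ 1), twoTerm V W j) ≤ twoTerm V W 0 := by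
          refine iSup₂_le fun j hj => ?_
          by_cases h0 : j = 0
          · rw [h0]
          · intro v hv
            rw [(mem_twoTerm_of_ne h0 hj).1 hv]
            exact zero_mem _
        refine Disjoint.mono_right this ?_
        rw [Submodule.disjoint_def]
        intro v hv hv'
        exact Prod.ext (mem_twoTerm_one.1 hv) (mem_twoTerm_zero.1 hv')
      · simp [twoTerm, h0, h1]
  · refine eq_top_iff.2 fun v _ => ?_
    have : v = (v.1, 0) + (0, v.2) := by simp
    rw [this]
    refine add_mem ?_ ?_
    · exact Submodule.mem_iSup_of_mem 0 (mem_twoTerm_zero.2 rfl)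
    · exact Submodule.mem_iSup_of_mem 1 (mem_twoTerm_one.2 rfl)

/-- The two-term cochain complex given by a linear map `δ : V → W`, in degrees `0` and `1`. -/
def CochainCx.ofLinearMap (δ : V →ₗ[ℝ] W) : CochainCx (V × W) where
  gr := twoTerm V W
  isInternal := twoTerm_isInternal
  d := LinearMap.inr ℝ V W ∘ₗ δ ∘ₗ LinearMap.fst ℝ V W
  d_degree k v hv := by
    by_cases h0 : k = 0
    · subst h0
      exact mem_twoTerm_one.2 rfl
    · have hv1 : v.1 = 0 := by
        by_cases h1 : k = 1
        · subst h1; exact mem_twoTerm_one.1 hv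
        · rw [(mem_twoTerm_of_ne h0 h1).1 hv]; rfl
      simp only [LinearMap.comp_apply, LinearMap.fst_apply, hv1, map_zero]
      exact zero_mem _
  d_d v := by simp

@[simp]
theorem CochainCx.ofLinearMap_d (δ : V →ₗ[ℝ] W) (v : V × W) :
    (CochainCx.ofLinearMap δ).d v = (0, δ v.1) := rfl

/-- A commutative square as a cochain map of two-term complexes. -/
def CochainMap.ofSquare {V' W' : Type*} [AddCommGroup V'] [Module ℝ V'] [AddCommGroup W']
    [Module ℝ W'] {δ : V →ₗ[ℝ] W} {δ' : V' →ₗ[ℝ] W'} (f₀ : V →ₗ[ℝ] V') (f₁ : W →ₗ[ℝ] W')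
    (h : ∀ v, f₁ (δ v) = δ' (f₀ v)) :
    CochainMap (CochainCx.ofLinearMap δ) (CochainCx.ofLinearMap δ') where
  toLinearMap := f₀.prodMap f₁
  map_degree k v hv := by
    change v ∈ twoTerm V W k at hv
    change _ ∈ twoTerm V' W' k
    by_cases h0 : k = 0
    · subst h0
      rw [mem_twoTerm_zero] at hv ⊢
      simp [hv]
    · by_cases h1 : k = 1
      · subst h1
        rw [mem_twoTerm_one] at hv ⊢
        simp [hv]
      · rw [mem_twoTerm_of_ne h0 h1] at hv ⊢
        simp [hv]
  map_d v := by simp [h]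

variable (L : Type*) [LieRing L] [LieAlgebra ℝ L] {L' : Type*} [LieRing L'] [LieAlgebra ℝ L']

/-- The Chevalley-Eilenberg codifferential `Λ² L → L`, `x ∧ y ↦ [x, y]`. -/
def ceDifferential : ⋀[ℝ]^2 L →ₗ[ℝ] L := exteriorPower.alternatingMapLinearEquiv (lieBracketAlt L)

/-- The Chevalley-Eilenberg complex `C(L)` of a Lie algebra, shifted by `2` and truncated to the
degrees `0` and `1`.  With `L` placed in degree one, `C(L)^n = (S^• L)_{2 - n}`, and the `k`-th
graded symmetric power of `L` is `Λ^k L` in degree `k`; so `C(L)^0 = Λ² L` and `C(L)^1 = L`. -/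
abbrev ceComplex : CochainCx (⋀[ℝ]^2 L × L) := CochainCx.ofLinearMap (ceDifferential L)

variable {L}

@[simp]
theorem ceDifferential_ιMulti (v : Fin 2 → L) :
    ceDifferential L (exteriorPower.ιMulti ℝ 2 v) = ⁅v 0, v 1⁆ := by
  simp [ceDifferential, lieBracketAlt]

/-- The cochain map `C(L) → C(L')` induced by a morphism of Lie algebras. -/
def ceMap (φ : L →ₗ⁅ℝ⁆ L') : CochainMap (ceComplex L) (ceComplex L') :=
  CochainMap.ofSquare (exteriorPower.map 2 (φ : L →ₗ[ℝ] L')) (φ : L →ₗ[ℝ] L') (by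
    intro v
    have : (φ : L →ₗ[ℝ] L') ∘ₗ ceDifferential L =
        ceDifferential L' ∘ₗ exteriorPower.map 2 (φ : L →ₗ[ℝ] L') := by
      apply exteriorPower.linearMap_ext
      ext w
      simp [exteriorPower.map_apply_ιMulti]
    exact LinearMap.congr_fun this v)

end Cochain

/-! ## Calculus on manifolds -/

section Geometry

variable {E : Type*} [NormedAddCommGroup E] [NormedSpace ℝ E] [FiniteDimensional ℝ E]
  {M : Type*} [TopologicalSpace M] [ChartedSpace E M] [IsManifold 𝓘(ℝ, E) (⊤ : ℕ∞) M]

variable (E M) in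
/-- Smooth functions on `M`. -/
abbrev SmoothFn := ContMDiffMap 𝓘(ℝ, E) 𝓘(ℝ, ℝ) M ℝ (⊤ : ℕ∞)

variable (E M) in
/-- Smooth vector fields on `M`. -/
abbrev VField := ContMDiffSection 𝓘(ℝ, E) E (⊤ : ℕ∞) (TangentSpace 𝓘(ℝ, E) : M → Type _)

variable (E M) in
/-- Smooth `1`-forms on `M`. -/
abbrev OneForm :=
  ContMDiffSection 𝓘(ℝ, E) (E →L[ℝ] ℝ) (⊤ : ℕ∞) (fun p : M => TangentSpace 𝓘(ℝ, E) p →L[ℝ] ℝ)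

variable (E M) in
/-- Smooth `2`-forms on `M`: smooth families of alternating bilinear forms on the tangent spaces. -/
structure TwoForm where
  /-- the underlying smooth section of the bundle of bilinear forms -/
  toSection : ContMDiffSection 𝓘(ℝ, E) (E →L[ℝ] E →L[ℝ] ℝ) (⊤ : ℕ∞)
    (fun p : M => TangentSpace 𝓘(ℝ, E) p →L[ℝ] TangentSpace 𝓘(ℝ, E) p →L[ℝ] ℝ)
  alternating : ∀ (p : M) (v : TangentSpace 𝓘(ℝ, E) p), toSection p v v = 0

instance : SMul (SmoothFn E M) (VField E M) :=
  ⟨fun f X => ⟨(f : M → ℝ) • (X : ∀ p : M, TangentSpace 𝓘(ℝ, E) p),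
    ContMDiff.smul_section f.contMDiff X.contMDiff⟩⟩

@[simp]
theorem VField.fun_smul_apply (f : SmoothFn E M) (X : VField E M) (p : M) :
    (f • X) p = f p • X p := rfl

/-- Vector fields form a module over the smooth functions. -/
instance : Module (SmoothFn E M) (VField E M) where
  one_smul X := by ext p; simp
  mul_smul f g X := by ext p; simp [mul_smul]
  smul_zero f := by ext p; simp
  smul_add f X Y := by ext p; simp
  add_smul f g X := by ext p; simp [add_smul]
  zero_smul X := by ext p; simp

/-- The value `α(X)` of a `1`-form on a vector field. -/
def OneForm.eval (α : OneForm E M) (X : VField E M) : SmoothFn E M :=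
  ⟨fun p => α p (X p), by
    intro p
    have h := ContMDiffAt.clm_bundle_apply (b := id) (F₁ := E) (F₂ := ℝ)
      (E₁ := (TangentSpace 𝓘(ℝ, E) : M → Type _)) (E₂ := Bundle.Trivial M ℝ)
      (v := fun p => X p) (ϕ := fun p => α p) (α.contMDiff p) (X.contMDiff p)
    simpa [Bundle.contMDiffAt_section] using h⟩

/-- The value `ω(X, Y)` of a `2`-form on vector fields. -/
def TwoForm.eval (ω : TwoForm E M) (X Y : VField E M) : SmoothFn E M :=
  ⟨fun p => ω.toSection p (X p) (Y p), by
    intro p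
    have h := ContMDiffAt.clm_bundle_apply₂ (b := id) (F₁ := E) (F₂ := E) (F₃ := ℝ)
      (E₁ := (TangentSpace 𝓘(ℝ, E) : M → Type _)) (E₂ := (TangentSpace 𝓘(ℝ, E) : M → Type _))
      (E₃ := Bundle.Trivial M ℝ)
      (v := fun p => X p) (w := fun p => Y p) (ψ := fun p => ω.toSection p)
      (ω.toSection.contMDiff p) (X.contMDiff p) (Y.contMDiff p)
    simpa [Bundle.contMDiffAt_section] using h⟩

/-- The contraction `ι_X ω = ω(X, ·)`. -/
def TwoForm.contract (ω : TwoForm E M) (X : VField E M) : OneForm E M :=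
  ⟨fun p => ω.toSection p (X p), by
    intro p
    exact ContMDiffAt.clm_bundle_apply (b := id) (F₁ := E) (F₂ := E →L[ℝ] ℝ)
      (E₁ := (TangentSpace 𝓘(ℝ, E) : M → Type _))
      (E₂ := fun p : M => TangentSpace 𝓘(ℝ, E) p →L[ℝ] ℝ)
      (v := fun p => X p) (ϕ := fun p => ω.toSection p)
      (ω.toSection.contMDiff p) (X.contMDiff p)⟩

/-- The differential `df` of a smooth function. -/
def extDeriv₀ (f : SmoothFn E M) : OneForm E M where
  toFun p := mvfderiv 𝓘(ℝ, E) f p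
  contMDiff_toFun := by
    intro p
    rw [contMDiffAt_hom_bundle]
    refine ⟨contMDiffAt_id, ?_⟩
    have h := ContMDiffAt.mfderiv_const (m := (⊤ : ℕ∞)) (f.contMDiff.contMDiffAt (x := p)) (by simp)
    convert h using 1
    ext x v
    simp [ContinuousLinearMap.inCoordinates, inTangentCoordinates, mvfderiv]
    rfl

/-- The derivative `X f = df(X)` of a function along a vector field. -/
def VField.deriv (X : VField E M) (f : SmoothFn E M) : SmoothFn E M := (extDeriv₀ f).eval X

theorem isManifold_of_le {n : WithTop ℕ∞} (hn : n ≤ ((⊤ : ℕ∞) : WithTop ℕ∞)) :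
    IsManifold 𝓘(ℝ, E) n M :=
  IsManifold.of_le (n := ((⊤ : ℕ∞) : WithTop ℕ∞)) hn

theorem minSmoothness_le (k : ℕ∞) :
    minSmoothness ℝ (k : WithTop ℕ∞) ≤ ((⊤ : ℕ∞) : WithTop ℕ∞) := by
  simp

/-- The Lie bracket of vector fields. -/
def VField.bracket (X Y : VField E M) : VField E M :=
  ⟨VectorField.mlieBracket 𝓘(ℝ, E) X Y, by
    have : IsManifold 𝓘(ℝ, E) (minSmoothness ℝ 2) M := isManifold_of_le (minSmoothness_le 2)
    have : IsManifold 𝓘(ℝ, E) (((⊤ : ℕ∞) : WithTop ℕ∞) + 1) M := by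
      simpa using (inferInstance : IsManifold 𝓘(ℝ, E) (⊤ : ℕ∞) M)
    have : CompleteSpace E := FiniteDimensional.complete ℝ E
    exact ContDiff.mlieBracket_vectorField (I := 𝓘(ℝ, E)) (m := ⊤) (n := ⊤) (U := X) (V := Y)
      X.contMDiff Y.contMDiff (by simp)⟩

instance : Bracket (VField E M) (VField E M) := ⟨VField.bracket⟩

theorem VField.lie_apply (X Y : VField E M) (p : M) :
    ⁅X, Y⁆ p = VectorField.mlieBracket 𝓘(ℝ, E) X Y p := rfl

theorem VField.lie_coe (X Y : VField E M) :
    (⁅X, Y⁆ : VField E M) = (VectorField.mlieBracket 𝓘(ℝ, E) X Y : ∀ p : M, TangentSpace 𝓘(ℝ, E) p) :=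
  rfl

theorem VField.mdifferentiableAt (X : VField E M) (p : M) :
    MDifferentiableAt 𝓘(ℝ, E) 𝓘(ℝ, E).tangent
      (fun p => (⟨p, X p⟩ : TangentBundle 𝓘(ℝ, E) M)) p :=
  (X.contMDiff p).mdifferentiableAt (by simp)

theorem SmoothFn.mdifferentiableAt (f : SmoothFn E M) (p : M) :
    MDifferentiableAt 𝓘(ℝ, E) 𝓘(ℝ, ℝ) f p :=
  (f.contMDiff p).mdifferentiableAt (by simp)

/-- Vector fields form a Lie ring. -/
instance : LieRing (VField E M) where
  add_lie X Y Z := by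
    ext p
    have : IsManifold 𝓘(ℝ, E) (minSmoothness ℝ 2) M := isManifold_of_le (minSmoothness_le 2)
    have : CompleteSpace E := FiniteDimensional.complete ℝ E
    exact VectorField.mlieBracket_add_left (X.mdifferentiableAt p) (Y.mdifferentiableAt p)
  lie_add X Y Z := by
    ext p
    have : IsManifold 𝓘(ℝ, E) (minSmoothness ℝ 2) M := isManifold_of_le (minSmoothness_le 2)
    have : CompleteSpace E := FiniteDimensional.complete ℝ E
    exact VectorField.mlieBracket_add_right (Y.mdifferentiableAt p) (Z.mdifferentiableAt p)
  lie_self X := by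
    ext p
    simp [VField.lie_apply]
  leibniz_lie X Y Z := by
    ext p
    have : IsManifold 𝓘(ℝ, E) (minSmoothness ℝ 3) M := isManifold_of_le (minSmoothness_le 3)
    have : CompleteSpace E := FiniteDimensional.complete ℝ E
    exact VectorField.leibniz_identity_mlieBracket_apply
      ((X.contMDiff p).of_le (minSmoothness_le 2)) ((Y.contMDiff p).of_le (minSmoothness_le 2))
      ((Z.contMDiff p).of_le (minSmoothness_le 2))

/-- Vector fields form a real Lie algebra. -/
instance : LieAlgebra ℝ (VField E M) where
  lie_smul c X Y := by
    ext p
    have : IsManifold 𝓘(ℝ, E) (minSmoothness ℝ 2) M := isManifold_of_le (minSmoothness_le 2)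
    have : CompleteSpace E := FiniteDimensional.complete ℝ E
    exact VectorField.mlieBracket_const_smul_right (Y.mdifferentiableAt p)

theorem VField.lie_fun_smul (X Y : VField E M) (f : SmoothFn E M) :
    ⁅X, f • Y⁆ = X.deriv f • Y + f • ⁅X, Y⁆ := by
  ext p
  have : IsManifold 𝓘(ℝ, E) (minSmoothness ℝ 2) M := isManifold_of_le (minSmoothness_le 2)
  have : CompleteSpace E := FiniteDimensional.complete ℝ E
  exact VectorField.mlieBracket_smul_right (f.mdifferentiableAt p) (Y.mdifferentiableAt p)

theorem exists_vField [T2Space M] (p : M) (v : TangentSpace 𝓘(ℝ, E) p) :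
    ∃ X : VField E M, X p = v := by
  obtain ⟨s, hs, hsv⟩ := FiberBundle.exists_contMDiffOn_extend (k := (⊤ : ℕ∞)) 𝓘(ℝ, E) E v
  obtain ⟨ρ, hρ⟩ :=
    (SmoothBumpFunction.nhds_basis_tsupport (I := 𝓘(ℝ, E)) p).mem_iff.1 (interior_mem_nhds.2 hs)
  refine ⟨⟨(ρ : M → ℝ) • FiberBundle.extend E v, ?_⟩, ?_⟩
  · exact ContMDiffOn.smul_section_of_tsupport ρ.contMDiff.contMDiffOn isOpen_interior hρ.2
      (hsv.mono interior_subset)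
  · simp

theorem VField.deriv_apply (X : VField E M) (f : SmoothFn E M) (p : M) :
    X.deriv f p = mvfderiv 𝓘(ℝ, E) f p (X p) := rfl

@[simp]
theorem VField.deriv_add (X : VField E M) (f g : SmoothFn E M) :
    X.deriv (f + g) = X.deriv f + X.deriv g := by
  ext p
  simp only [VField.deriv_apply, ContMDiffMap.coe_add]
  rw [mvfderiv_add (f.mdifferentiableAt p) (g.mdifferentiableAt p)]
  rfl

@[simp]
theorem VField.deriv_smul (X : VField E M) (c : ℝ) (f : SmoothFn E M) :
    X.deriv (c • f) = c • X.deriv f := by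
  ext p
  change (mfderiv 𝓘(ℝ, E) 𝓘(ℝ, ℝ) (c • (f : M → ℝ)) p) (X p) = c • _
  rw [const_smul_mfderiv (f.mdifferentiableAt p)]
  rfl

@[simp]
theorem VField.deriv_zero (X : VField E M) : X.deriv 0 = 0 := by
  simpa using X.deriv_smul 0 0

@[simp]
theorem VField.add_deriv (X Y : VField E M) (f : SmoothFn E M) :
    (X + Y).deriv f = X.deriv f + Y.deriv f := by
  ext p
  simp [VField.deriv_apply]

@[simp]
theorem VField.smul_deriv (X : VField E M) (c : ℝ) (f : SmoothFn E M) :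
    (c • X).deriv f = c • X.deriv f := by
  ext p
  simp [VField.deriv_apply]

theorem VField.lie_deriv [T2Space M] (X Y : VField E M) (f : SmoothFn E M) :
    ⁅X, Y⁆.deriv f = X.deriv (Y.deriv f) - Y.deriv (X.deriv f) := by
  ext p
  rcases subsingleton_or_nontrivial E with hE | hE
  · have h : ∀ (Z : VField E M) (g : SmoothFn E M), Z.deriv g p = 0 := by
      intro Z g
      rw [VField.deriv_apply]
      have : Z p = 0 := hE.elim (α := E) _ _
      rw [this, map_zero]
    change _ = X.deriv (Y.deriv f) p - Y.deriv (X.deriv f) p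
    rw [h, h, h, sub_zero]
  · obtain ⟨v, hv⟩ := exists_ne (0 : E)
    obtain ⟨Z, hZ⟩ := exists_vField (E := E) p v
    have key : (⁅X, Y⁆.deriv f - (X.deriv (Y.deriv f) - Y.deriv (X.deriv f))) • Z = 0 := by
      have h := leibniz_lie X Y (f • Z)
      simp only [VField.lie_fun_smul, lie_add] at h
      rw [leibniz_lie X Y Z] at h
      simp only [smul_add, sub_smul] at h ⊢
      rw [← sub_eq_zero] at h
      rw [← neg_eq_zero, ← h]
      abel
    have hp := congrArg (fun W : VField E M => W p) key
    have hp' : (⁅X, Y⁆.deriv f p - (X.deriv (Y.deriv f) p - Y.deriv (X.deriv f) p)) • v = 0 := by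
      rw [← hZ]; exact hp
    exact sub_eq_zero.1 ((smul_eq_zero.1 hp').resolve_right hv)

/-! ### Two-forms -/

@[simp]
theorem OneForm.add_eval (α β : OneForm E M) (X : VField E M) :
    (α + β).eval X = α.eval X + β.eval X := rfl

@[simp]
theorem OneForm.smul_eval (c : ℝ) (α : OneForm E M) (X : VField E M) :
    (c • α).eval X = c • α.eval X := rfl

theorem OneForm.ext_eval [T2Space M] {α β : OneForm E M}
    (h : ∀ X : VField E M, α.eval X = β.eval X) : α = β := by
  refine ContMDiffSection.ext fun p => ContinuousLinearMap.ext fun v => ?_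
  obtain ⟨X, rfl⟩ := exists_vField (E := E) p v
  exact congrArg (fun f : SmoothFn E M => f p) (h X)

theorem OneForm.ext_apply {α β : OneForm E M}
    (h : ∀ (p : M) (v : TangentSpace 𝓘(ℝ, E) p), α p v = β p v) : α = β := by
  exact ContMDiffSection.ext fun p => ContinuousLinearMap.ext fun v => h p v

namespace TwoForm

variable (ω : TwoForm E M)

@[simp]
theorem contract_eval (X Y : VField E M) : (ω.contract X).eval Y = ω.eval X Y := rfl

@[simp]
theorem add_eval (X X' Y : VField E M) : ω.eval (X + X') Y = ω.eval X Y + ω.eval X' Y := by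
  ext p
  change ω.toSection p (X p + X' p) (Y p) = ω.toSection p (X p) (Y p) + ω.toSection p (X' p) (Y p)
  simp

@[simp]
theorem eval_add (X Y Y' : VField E M) : ω.eval X (Y + Y') = ω.eval X Y + ω.eval X Y' := by
  ext p
  change ω.toSection p (X p) (Y p + Y' p) = ω.toSection p (X p) (Y p) + ω.toSection p (X p) (Y' p)
  simp

@[simp]
theorem smul_eval (c : ℝ) (X Y : VField E M) : ω.eval (c • X) Y = c • ω.eval X Y := by
  ext p
  change ω.toSection p (c • X p) (Y p) = c * ω.toSection p (X p) (Y p)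
  simp

@[simp]
theorem eval_smul (c : ℝ) (X Y : VField E M) : ω.eval X (c • Y) = c • ω.eval X Y := by
  ext p
  change ω.toSection p (X p) (c • Y p) = c * ω.toSection p (X p) (Y p)
  simp

@[simp]
theorem eval_self (X : VField E M) : ω.eval X X = 0 := by
  ext p; exact ω.alternating p (X p)

theorem eval_swap (X Y : VField E M) : ω.eval X Y = -ω.eval Y X := by
  have h := ω.eval_self (X + Y)
  rw [add_eval, eval_add, eval_add, eval_self, eval_self, zero_add, add_zero] at h
  exact eq_neg_of_add_eq_zero_left h

@[simp]
theorem contract_add (X Y : VField E M) : ω.contract (X + Y) = ω.contract X + ω.contract Y := by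
  refine OneForm.ext_apply fun p v => ?_
  change ω.toSection p (X p + Y p) v = ω.toSection p (X p) v + ω.toSection p (Y p) v
  simp

@[simp]
theorem contract_smul (c : ℝ) (X : VField E M) : ω.contract (c • X) = c • ω.contract X := by
  refine OneForm.ext_apply fun p v => ?_
  change ω.toSection p (c • X p) v = c * ω.toSection p (X p) v
  simp

@[simp]
theorem zero_eval (Y : VField E M) : ω.eval 0 Y = 0 := by
  simpa using ω.smul_eval 0 0 Y

@[simp]
theorem contract_zero : ω.contract 0 = 0 := by
  refine OneForm.ext_apply fun p v => ?_
  change ω.toSection p 0 v = 0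
  simp

/-- The exterior derivative `(dω)(X, Y, Z)`. -/
def extDeriv (X Y Z : VField E M) : SmoothFn E M :=
  X.deriv (ω.eval Y Z) + Y.deriv (ω.eval Z X) + Z.deriv (ω.eval X Y)
    - ω.eval ⁅X, Y⁆ Z - ω.eval ⁅Y, Z⁆ X - ω.eval ⁅Z, X⁆ Y

/-- The Lie derivative `(L_X ω)(Y, Z)`. -/
def lieDeriv (X Y Z : VField E M) : SmoothFn E M :=
  X.deriv (ω.eval Y Z) - ω.eval ⁅X, Y⁆ Z - ω.eval Y ⁅X, Z⁆

end TwoForm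

@[simp]
theorem extDeriv₀_eval (f : SmoothFn E M) (X : VField E M) : (extDeriv₀ f).eval X = X.deriv f := rfl

variable (E M) in
/-- The de Rham differential `C^∞(M) → Ω¹(M)`. -/
def extDerivLinear : SmoothFn E M →ₗ[ℝ] OneForm E M where
  toFun := extDeriv₀
  map_add' f g := by
    refine OneForm.ext_apply fun p v => ?_
    change mvfderiv 𝓘(ℝ, E) (f + g : M → ℝ) p v = _
    rw [mvfderiv_add (f.mdifferentiableAt p) (g.mdifferentiableAt p)]
    rfl
  map_smul' c f := by
    refine OneForm.ext_apply fun p v => ?_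
    change (mfderiv 𝓘(ℝ, E) 𝓘(ℝ, ℝ) (c • (f : M → ℝ)) p) v = _
    rw [const_smul_mfderiv (f.mdifferentiableAt p)]
    rfl

@[simp]
theorem extDerivLinear_apply (f : SmoothFn E M) : extDerivLinear E M f = extDeriv₀ f := rfl

/-! ### Pre-symplectic forms, symplectic and Hamiltonian vector fields -/

variable (E M) in
/-- A pre-symplectic form: a closed `2`-form (possibly degenerate). -/
structure PreSymplecticForm extends TwoForm E M where
  closed : ∀ X Y Z : VField E M, toTwoForm.extDeriv X Y Z = 0

namespace PreSymplecticForm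

variable (ω : PreSymplecticForm E M)

/-- `X` preserves `ω`, that is, `L_X ω = 0`. -/
def IsSymplectic (X : VField E M) : Prop := ∀ Y Z : VField E M, ω.lieDeriv X Y Z = 0

/-- `f` is a Hamiltonian function of `X`, that is, `ι_X ω = df`. -/
def IsHamiltonian (X : VField E M) (f : SmoothFn E M) : Prop := ω.contract X = extDeriv₀ f

variable {ω} {X Y : VField E M} {f g : SmoothFn E M}

theorem IsHamiltonian.deriv (h : ω.IsHamiltonian X f) (Y : VField E M) :
    Y.deriv f = ω.eval X Y := by
  rw [← extDeriv₀_eval, ← h, TwoForm.contract_eval]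

/-- Cartan's formula, for a closed form. -/
theorem lieDeriv_eq (X Y Z : VField E M) :
    ω.lieDeriv X Y Z = Y.deriv (ω.eval X Z) - Z.deriv (ω.eval X Y) - ω.eval X ⁅Y, Z⁆ := by
  have h := ω.closed X Y Z
  have hYd : Y.deriv (ω.eval Z X) = -Y.deriv (ω.eval X Z) := by
    rw [ω.eval_swap Z X, ← neg_one_smul ℝ (ω.eval X Z), VField.deriv_smul, neg_one_smul]
  have h1 : ω.eval ⁅Y, Z⁆ X = -ω.eval X ⁅Y, Z⁆ := ω.eval_swap _ _
  have h2 : ω.eval ⁅Z, X⁆ Y = ω.eval Y ⁅X, Z⁆ := by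
    rw [ω.eval_swap ⁅Z, X⁆ Y, ← lie_skew X Z, ← neg_one_smul ℝ ⁅Z, X⁆, TwoForm.eval_smul,
      neg_one_smul]
  rw [TwoForm.extDeriv, hYd, h1, h2] at h
  rw [TwoForm.lieDeriv, ← sub_eq_zero, ← h]
  abel

variable [T2Space M]

theorem IsHamiltonian.isSymplectic (h : ω.IsHamiltonian X f) : ω.IsSymplectic X := by
  intro Y Z
  rw [lieDeriv_eq, ← h.deriv, ← h.deriv, ← h.deriv, VField.lie_deriv]
  abel

/-- For symplectic vector fields `X` and `Y`, the function `ι_X ι_Y ω = ω(Y, X)` is a Hamiltonian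
function of `[X, Y]`. -/
theorem IsSymplectic.isHamiltonian_lie (hX : ω.IsSymplectic X) (hY : ω.IsSymplectic Y) :
    ω.IsHamiltonian ⁅X, Y⁆ (ω.eval Y X) := by
  refine OneForm.ext_eval fun Z => ?_
  have h1 := hX Y Z
  have h2 := hY X Z
  rw [lieDeriv_eq] at h2
  rw [TwoForm.lieDeriv] at h1
  rw [TwoForm.contract_eval, extDeriv₀_eval, ← sub_eq_zero, ← sub_eq_zero.2 (h2.trans h1.symm)]
  abel

variable (ω)

/-- The Lie algebra of symplectic vector fields. -/
def symplecticVFields : LieSubalgebra ℝ (VField E M) where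
  carrier := {X | ω.IsSymplectic X}
  zero_mem' := by
    intro Y Z
    rw [lieDeriv_eq, TwoForm.zero_eval, TwoForm.zero_eval, TwoForm.zero_eval, VField.deriv_zero,
      VField.deriv_zero]
    abel
  add_mem' {X X'} hX hX' := by
    intro Y Z
    have h1 := hX Y Z
    have h2 := hX' Y Z
    rw [lieDeriv_eq] at h1 h2 ⊢
    rw [TwoForm.add_eval, TwoForm.add_eval, TwoForm.add_eval, VField.deriv_add, VField.deriv_add]
    rw [← add_zero (0 : SmoothFn E M)]
    nth_rewrite 1 [← h1]
    rw [← h2]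
    abel
  smul_mem' c X hX := by
    intro Y Z
    have h1 := hX Y Z
    rw [lieDeriv_eq] at h1 ⊢
    rw [TwoForm.smul_eval, TwoForm.smul_eval, TwoForm.smul_eval, VField.deriv_smul,
      VField.deriv_smul, ← smul_sub, ← smul_sub, h1, smul_zero]
  lie_mem' {X Y} hX hY := (IsSymplectic.isHamiltonian_lie hX hY).isSymplectic

/-- Hamiltonian functions: those admitting a Hamiltonian vector field. -/
def hamFunctions : Submodule ℝ (SmoothFn E M) where
  carrier := {f | ∃ X, ω.IsHamiltonian X f}
  zero_mem' := ⟨0, by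
    exact ω.contract_zero.trans (extDerivLinear E M).map_zero.symm⟩
  add_mem' := by
    rintro f g ⟨X, hX⟩ ⟨Y, hY⟩
    exact ⟨X + Y, by
      rw [IsHamiltonian, TwoForm.contract_add, hX, hY]
      exact ((extDerivLinear E M).map_add f g).symm⟩
  smul_mem' := by
    rintro c f ⟨X, hX⟩
    exact ⟨c • X, by
      rw [IsHamiltonian, TwoForm.contract_smul, hX]
      exact ((extDerivLinear E M).map_smul c f).symm⟩

/-- Hamiltonian pairs `(X, f)`: `f` is a Hamiltonian function of `X`. -/
def hamPairs : Submodule ℝ (VField E M × SmoothFn E M) where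
  carrier := {P | ω.IsHamiltonian P.1 P.2}
  zero_mem' := by
    exact ω.contract_zero.trans (extDerivLinear E M).map_zero.symm
  add_mem' := by
    intro P Q hP hQ
    change ω.contract (P.1 + Q.1) = _
    rw [TwoForm.contract_add, hP, hQ]
    exact ((extDerivLinear E M).map_add P.2 Q.2).symm
  smul_mem' := by
    intro c P hP
    change ω.contract (c • P.1) = _
    rw [TwoForm.contract_smul, hP]
    exact ((extDerivLinear E M).map_smul c P.2).symm

theorem hamPairs_lie_mem (P Q : ω.hamPairs) :
    (⁅P.1.1, Q.1.1⁆, ω.eval Q.1.1 P.1.1) ∈ ω.hamPairs :=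
  IsSymplectic.isHamiltonian_lie (IsHamiltonian.isSymplectic P.2) (IsHamiltonian.isSymplectic Q.2)

/-- The bracket `[(X, f), (Y, g)] = ([X, Y], ι_X ι_Y ω)` of Hamiltonian pairs. -/
instance : Bracket ω.hamPairs ω.hamPairs :=
  ⟨fun P Q => ⟨(⁅P.1.1, Q.1.1⁆, ω.eval Q.1.1 P.1.1), ω.hamPairs_lie_mem P Q⟩⟩

theorem hamPairs_lie (P Q : ω.hamPairs) :
    (⁅P, Q⁆ : ω.hamPairs).1 = (⁅P.1.1, Q.1.1⁆, ω.eval Q.1.1 P.1.1) := rfl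

instance : LieRing ω.hamPairs where
  add_lie P Q R := by
    ext : 1
    exact Prod.ext (add_lie P.1.1 Q.1.1 R.1.1) (ω.eval_add R.1.1 P.1.1 Q.1.1)
  lie_add P Q R := by
    ext : 1
    exact Prod.ext (lie_add P.1.1 Q.1.1 R.1.1) (ω.add_eval Q.1.1 R.1.1 P.1.1)
  lie_self P := by
    ext : 1
    exact Prod.ext (lie_self P.1.1) (ω.eval_self P.1.1)
  leibniz_lie P Q R := by
    ext : 1
    refine Prod.ext (leibniz_lie P.1.1 Q.1.1 R.1.1) ?_
    change ω.eval ⁅Q.1.1, R.1.1⁆ P.1.1 = ω.eval R.1.1 ⁅P.1.1, Q.1.1⁆ + ω.eval ⁅P.1.1, R.1.1⁆ Q.1.1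
    have hP := IsHamiltonian.isSymplectic P.2
    have h := IsSymplectic.isHamiltonian_lie (IsHamiltonian.isSymplectic Q.2)
      (IsHamiltonian.isSymplectic R.2)
    rw [← h.deriv, ← sub_eq_zero, ← hP R.1.1 Q.1.1, TwoForm.lieDeriv]
    abel

/-- Hamiltonian pairs form a real Lie algebra. -/
instance : LieAlgebra ℝ ω.hamPairs where
  lie_smul c P Q := by
    ext : 1
    exact Prod.ext (lie_smul c P.1.1 Q.1.1) (ω.smul_eval c Q.1.1 P.1.1)

/-- A choice of Hamiltonian vector field of a Hamiltonian function; the Poisson bracket does not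
depend on it. -/
def hamVField (f : ω.hamFunctions) : VField E M := f.2.choose

theorem isHamiltonian_hamVField (f : ω.hamFunctions) : ω.IsHamiltonian (ω.hamVField f) f :=
  f.2.choose_spec

/-- The Poisson bracket `{f, g} = ι_{X_f} ι_{X_g} ω = X_f (g)` of Hamiltonian functions. -/
instance : Bracket ω.hamFunctions ω.hamFunctions :=
  ⟨fun f g => ⟨ω.eval (ω.hamVField g) (ω.hamVField f), _,
    IsSymplectic.isHamiltonian_lie (ω.isHamiltonian_hamVField f).isSymplectic
      (ω.isHamiltonian_hamVField g).isSymplectic⟩⟩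

variable {ω} in
theorem hamFunctions_lie {f g : ω.hamFunctions} (hX : ω.IsHamiltonian X f)
    (hY : ω.IsHamiltonian Y g) : ((⁅f, g⁆ : ω.hamFunctions) : SmoothFn E M) = ω.eval Y X := by
  change ω.eval (ω.hamVField g) (ω.hamVField f) = _
  rw [← (ω.isHamiltonian_hamVField g).deriv, hY.deriv, ω.eval_swap Y, ω.eval_swap Y,
    ← (ω.isHamiltonian_hamVField f).deriv, ← hX.deriv]

theorem hamFunctions_lie_eq_deriv {f : ω.hamFunctions} (g : ω.hamFunctions)
    (hX : ω.IsHamiltonian X f) : ((⁅f, g⁆ : ω.hamFunctions) : SmoothFn E M) = X.deriv g := by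
  rw [hamFunctions_lie hX (ω.isHamiltonian_hamVField g), (ω.isHamiltonian_hamVField g).deriv]

variable {ω} in
theorem isHamiltonian_lie {f g : ω.hamFunctions} (hX : ω.IsHamiltonian X f)
    (hY : ω.IsHamiltonian Y g) : ω.IsHamiltonian ⁅X, Y⁆ (⁅f, g⁆ : ω.hamFunctions) := by
  rw [hamFunctions_lie hX hY]
  exact IsSymplectic.isHamiltonian_lie hX.isSymplectic hY.isSymplectic

variable {ω} in
theorem IsHamiltonian.add (hX : ω.IsHamiltonian X f) (hY : ω.IsHamiltonian Y g) :
    ω.IsHamiltonian (X + Y) (f + g) :=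
  ω.hamPairs.add_mem (x := (X, f)) (y := (Y, g)) hX hY

instance : LieRing ω.hamFunctions where
  add_lie f g h := by
    ext : 1
    have hf := ω.isHamiltonian_hamVField f
    have hg := ω.isHamiltonian_hamVField g
    rw [ω.hamFunctions_lie_eq_deriv (f := f + g) h (hf.add hg), Submodule.coe_add,
      ω.hamFunctions_lie_eq_deriv h hf, ω.hamFunctions_lie_eq_deriv h hg, VField.add_deriv]
  lie_add f g h := by
    ext : 1
    have hf := ω.isHamiltonian_hamVField f
    rw [ω.hamFunctions_lie_eq_deriv _ hf, Submodule.coe_add, Submodule.coe_add,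
      ω.hamFunctions_lie_eq_deriv _ hf, ω.hamFunctions_lie_eq_deriv _ hf, VField.deriv_add]
  lie_self f := by
    ext : 1
    exact ω.eval_self _
  leibniz_lie f g h := by
    ext : 1
    have hf := ω.isHamiltonian_hamVField f
    have hg := ω.isHamiltonian_hamVField g
    rw [Submodule.coe_add, ω.hamFunctions_lie_eq_deriv _ hf, ω.hamFunctions_lie_eq_deriv _ hg,
      ω.hamFunctions_lie_eq_deriv _ hg, ω.hamFunctions_lie_eq_deriv _ hf,
      ω.hamFunctions_lie_eq_deriv _ (isHamiltonian_lie hf hg), VField.lie_deriv]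
    abel

/-- Hamiltonian functions form a real Lie algebra under the Poisson bracket. -/
instance : LieAlgebra ℝ ω.hamFunctions where
  lie_smul c f g := by
    ext : 1
    have hf := ω.isHamiltonian_hamVField f
    rw [ω.hamFunctions_lie_eq_deriv _ hf, Submodule.coe_smul, Submodule.coe_smul,
      ω.hamFunctions_lie_eq_deriv _ hf, VField.deriv_smul]

end PreSymplecticForm

end Geometry

/-! ## Momentum maps -/

section Momentum

variable {E : Type*} [NormedAddCommGroup E] [NormedSpace ℝ E] [FiniteDimensional ℝ E]
  {M : Type*} [TopologicalSpace M] [ChartedSpace E M] [IsManifold 𝓘(ℝ, E) (⊤ : ℕ∞) M]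

/-! ### The two L-infinity structures on vector fields -/

/-- The higher bracket `ν_n` on multivector fields, evaluated on `n` vector fields:
`∑_{σ ∈ Sh(2, n - 2)} ε(σ) [X_{σ 1}, X_{σ 2}] ∧ X_{σ 3} ∧ ⋯ ∧ X_{σ n}`, a multivector field of degree
`n - 1`.  Multivector fields are elements of the exterior algebra of the module of vector fields over
the ring of smooth functions. -/
def higherBracket : ∀ n : ℕ, (Fin n → VField E M) → ExteriorAlgebra (SmoothFn E M) (VField E M)
  | 0, _ => 0
  | 1, _ => 0
  | n + 2, X => ∑ σ : Equiv.Perm (Fin (n + 2)) with IsUnshuffle 2 σ,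
      koszulSign (fun _ => 1) σ •
        (ExteriorAlgebra.ι (SmoothFn E M) ⁅X (σ 0), X (σ 1)⁆ *
          (List.ofFn fun k : Fin n => ExteriorAlgebra.ι (SmoothFn E M) (X (σ k.succ.succ))).prod)

/-- The bracket `ν_n` truncated to vector fields: the component of degree one of `ν_n`. -/
def strongBracket (n : ℕ) (X : Fin n → VField E M) : VField E M :=
  ExteriorAlgebra.ιInv (higherBracket n X)

theorem ιInv_ι_mul {R N : Type*} [CommRing R] [AddCommGroup N] [Module R N] (a : N)
    (y : ExteriorAlgebra R N) :
    ExteriorAlgebra.ιInv (ExteriorAlgebra.ι R a * y) = ExteriorAlgebra.algebraMapInv y • a := by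
  let : Module Rᵐᵒᵖ N := Module.compHom _ ((RingHom.id R).fromOpposite mul_comm)
  have : IsCentralScalar R N := ⟨fun r m => rfl⟩
  have h : (TrivSqZeroExt.fstHom R R N).comp ExteriorAlgebra.toTrivSqZeroExt =
      ExteriorAlgebra.algebraMapInv := by
    ext x
    simp [ExteriorAlgebra.algebraMapInv]
  rw [← h]
  simp [ExteriorAlgebra.ιInv]

theorem strongBracket_eq (n : ℕ) (X : Fin n → VField E M) :
    strongBracket n X = lieBrackets (VField E M) n X := by
  match n with
  | 0 => simp [strongBracket, higherBracket, lieBrackets]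
  | 1 => simp [strongBracket, higherBracket, lieBrackets]
  | 2 =>
    have hS : (Finset.univ.filter fun σ : Equiv.Perm (Fin 2) => IsUnshuffle 2 σ) = {1} := by
      decide
    simp only [strongBracket, higherBracket]
    rw [hS, Finset.sum_singleton]
    simp only [koszulSign, List.ofFn_zero, List.prod_nil, mul_one]
    simpa using ExteriorAlgebra.ι_leftInverse (R := SmoothFn E M) ⁅X 0, X 1⁆
  | n + 3 =>
    simp only [strongBracket, higherBracket, map_sum, map_zsmul, ιInv_ι_mul]
    rw [lieBrackets_of_ne (by omega)]
    refine Finset.sum_eq_zero fun σ _ => ?_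
    simp [List.ofFn_succ, ExteriorAlgebra.algebraMapInv]

/-- The brackets `ν_n`, truncated to vector fields, as multilinear maps. -/
def strongBrackets (n : ℕ) : MultilinearMap ℝ (fun _ : Fin n => VField E M) (VField E M) where
  toFun := strongBracket n
  map_update_add' X i x y := by simp only [strongBracket_eq, MultilinearMap.map_update_add]
  map_update_smul' X i c x := by simp only [strongBracket_eq, MultilinearMap.map_update_smul]

theorem strongBrackets_eq (n : ℕ) :
    (strongBrackets n : MultilinearMap ℝ (fun _ : Fin n => VField E M) (VField E M)) =
      lieBrackets (VField E M) n :=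
  MultilinearMap.ext fun X => strongBracket_eq n X

variable (E M) in
/-- The truncation to vector fields of multivector fields with the Lie (Schouten) bracket. -/
abbrev vfieldLInfty : LInftyAlgebra (VField E M) := LInftyAlgebra.ofLie (VField E M)

variable (E M) in
/-- The truncation to vector fields of multivector fields with all the higher brackets `ν_n`. -/
def strongVFieldLInfty : LInftyAlgebra (VField E M) where
  gr := degreeOne (VField E M)
  isInternal := degreeOne_isInternal
  pos := (vfieldLInfty E M).pos
  l := strongBrackets
  l_degree n d x hx := by
    rw [strongBrackets_eq]; exact (vfieldLInfty E M).l_degree n d x hx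
  l_symm n d x hx := by
    rw [strongBrackets_eq]; exact (vfieldLInfty E M).l_symm n d x hx
  jacobi n d x hx := by
    rw [show strongBrackets = lieBrackets (VField E M) from funext strongBrackets_eq]
    exact (vfieldLInfty E M).jacobi n d x hx

theorem strongVFieldLInfty_eq : strongVFieldLInfty E M = vfieldLInfty E M :=
  LInftyAlgebra.ext rfl (funext strongBrackets_eq)

variable [T2Space M] {g : Type*} [LieRing g] [LieAlgebra ℝ g]

/-! ### The five kinds of momentum maps -/

section

variable (ω : PreSymplecticForm E M) (ρ : g →ₗ⁅ℝ⁆ ω.symplecticVFields)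

/-- The action by symplectic vector fields, as an `L_∞`-action: an `L_∞`-morphism to the truncated
multivector fields with the Schouten bracket. -/
def lInftyAction : LInftyMorphism (LInftyAlgebra.ofLie g) (vfieldLInfty E M) :=
  LInftyMorphism.ofLieHom rfl (ω.symplecticVFields.incl.comp ρ)

/-- The action by symplectic vector fields, as a strong `L_∞`-action: an `L_∞`-morphism to the
truncated multivector fields with all the higher brackets. -/
def strongAction : LInftyMorphism (LInftyAlgebra.ofLie g) (strongVFieldLInfty E M) :=
  LInftyMorphism.ofLieHom strongVFieldLInfty_eq (ω.symplecticVFields.incl.comp ρ)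

/-- A co-momentum map: a morphism of Lie algebras from `g` to the Hamiltonian functions with
`ι_{ρ x} ω = d(μ x)`. -/
structure CoMomentumMap where
  /-- the underlying morphism of Lie algebras -/
  μ : g →ₗ⁅ℝ⁆ ω.hamFunctions
  generating : ∀ x, ω.IsHamiltonian (ρ x) (μ x)

/-- The `L_∞`-algebra of Hamiltonian pairs: for a `2`-form it is concentrated in degree one, where it
consists of the pairs `(X, f)` with `ι_X ω = df`; the binary bracket is `([X, Y], ι_X ι_Y ω)`, and
all the others vanish. -/
abbrev hamPairsLInfty : LInftyAlgebra ω.hamPairs := LInftyAlgebra.ofLie ω.hamPairs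

/-- An `L_∞`-momentum map: an `L_∞`-morphism to the Hamiltonian pairs which lifts the `L_∞`-action
along the projection `(X, f) ↦ X`. -/
structure LInftyMomentumMap where
  /-- the underlying `L_∞`-morphism -/
  h : LInftyMorphism (LInftyAlgebra.ofLie g) (hamPairsLInfty ω)
  lift : ∀ (n : ℕ) (x : Fin n → g), (h.f n x).1.1 = (lInftyAction ω ρ).f n x

/-- A strong `L_∞`-momentum map: an `L_∞`-morphism to the Hamiltonian pairs which lifts, component
by component, the strong `L_∞`-action along the projection `(X, f) ↦ X`. -/
structure StrongLInftyMomentumMap where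
  /-- the underlying `L_∞`-morphism -/
  h : LInftyMorphism (LInftyAlgebra.ofLie g) (hamPairsLInfty ω)
  lift : ∀ (n : ℕ) (x : Fin n → g), (h.f n x).1.1 = (strongAction ω ρ).f n x

variable (E M) in
/-- The truncated de Rham complex `C^∞(M) → Ω¹(M)`, in degrees `0` and `1`. -/
abbrev deRhamTrunc : CochainCx (SmoothFn E M × OneForm E M) :=
  CochainCx.ofLinearMap (extDerivLinear E M)

/-- The map `X ∧ Y ↦ ι_X ι_Y ω = ω(Y, X)` on symplectic vector fields. -/
def contractTwo : ⋀[ℝ]^2 ω.symplecticVFields →ₗ[ℝ] SmoothFn E M :=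
  exteriorPower.alternatingMapLinearEquiv
    { toFun := fun X => ω.eval (X 1) (X 0)
      map_update_add' := by
        intro _ X i x y
        fin_cases i <;> simp
      map_update_smul' := by
        intro _ X i c x
        fin_cases i <;> simp
      map_eq_zero_of_eq' := by
        intro X i j hij hne
        fin_cases i <;> fin_cases j <;> simp_all }

@[simp]
theorem contractTwo_ιMulti (X : Fin 2 → ω.symplecticVFields) :
    contractTwo ω (exteriorPower.ιMulti ℝ 2 X) = ω.eval (X 1) (X 0) := by
  simp [contractTwo]

/-- The map `X ↦ ι_X ω` on symplectic vector fields. -/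
def contractOne : ω.symplecticVFields →ₗ[ℝ] OneForm E M where
  toFun X := ω.contract X
  map_add' X Y := ω.contract_add X Y
  map_smul' c X := ω.contract_smul c X

/-- The cochain map `x ↦ ι_x ω` from the Chevalley-Eilenberg complex of the symplectic vector fields
to the truncated de Rham complex. -/
def contraction : CochainMap (ceComplex ω.symplecticVFields) (deRhamTrunc E M) :=
  CochainMap.ofSquare (contractTwo ω) (contractOne ω) (by
    intro v
    have : contractOne ω ∘ₗ ceDifferential ω.symplecticVFields =
        extDerivLinear E M ∘ₗ contractTwo ω := by
      apply exteriorPower.linearMap_ext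
      ext X : 1
      simp only [LinearMap.compAlternatingMap_apply, LinearMap.comp_apply, ceDifferential_ιMulti,
        contractTwo_ιMulti]
      exact PreSymplecticForm.IsSymplectic.isHamiltonian_lie (X 0).2 (X 1).2
    exact LinearMap.congr_fun this v)

/-- A homotopy momentum map: a cochain null-homotopy of the composition
`C(g) → C(symplectic vector fields) → tr Ω^•(M)` of the map induced by the action and of the
contraction with `ω`. -/
abbrev HomotopyMomentumMap : Type _ :=
  CochainNullHomotopy ((contraction ω).comp (ceMap ρ))

/-- A homotopy Hamiltonian momentum map: a homotopy momentum map `h` with `(h ∘ l_1)(g) = 0`, where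
`l_1` is the unary bracket of `g`. -/
structure HomotopyHamiltonianMomentumMap where
  /-- the underlying homotopy momentum map -/
  toHomotopy : HomotopyMomentumMap ω ρ
  hamiltonian : ∀ x : g, toHomotopy.h (0, (LInftyAlgebra.ofLie g).l 1 ![x]) = 0

end

end Momentum
end MomentumMaps

end

open MomentumMaps

noncomputable section

namespace MomentumMaps

/-! ### `L_∞`-morphisms between Lie algebras -/

section LInfty

variable {L : Type*} [LieRing L] [LieAlgebra ℝ L] {L' : Type*} [LieRing L'] [LieAlgebra ℝ L']

/-! All five notions encode the same data: a linear map `μ : g → C^∞(M)` with `ι_{ρ x} ω = d(μ x)`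
and `μ [x, y] = ω(ρ y, ρ x)`. For co-momentum maps the second equation is the morphism property,
because the Poisson bracket may be computed with any Hamiltonian vector fields, in particular with
`ρ x` and `ρ y`, even when `ω` is degenerate (`CoMomentumMap.coe_lie`, `CoMomentumMap.ofLinearMap`).

The bracket of Hamiltonian pairs has the same formula `ω(Y, X)` as its second component, so the two
equations say exactly that `x ↦ (ρ x, μ x)` is a morphism of Lie algebras into the pairs
(`coMomentumEquivLift`). Passing to `L_∞`-morphisms adds nothing: both sides sit in degree one and
the `n`-th component has degree zero, so it sends degree `n` to degree `n` and vanishes unless `n =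
1`; the one compatibility equation with content is then the one for two arguments
(`LInftyMorphism.lieHomEquiv`). The strong version differs only in its target, and the degree-one
parts of the `ν_n` with `n ≥ 3` vanish, so the two actions have equal components.

On the cochain side, a map of degree `-1` between complexes in degrees `0` and `1` can be nonzero
only from `g` to `C^∞(M)`. The equation `f = h ∘ e + d ∘ h` then splits by degree: on `g` it is
`ι_{ρ x} ω = d(μ x)`, on `Λ² g` it is `μ [x, y] = ω(ρ y, ρ x)`. The extra Hamiltonian condition is
empty, as the unary bracket of a Lie algebra is zero. -/

theorem insertion_strictComponents_lieBrackets {W : Type*} [AddCommGroup W] [Module ℝ W]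
    (φ : L →ₗ[ℝ] W) (d : Fin 2 → ℤ) (x : Fin 2 → L) :
    insertion (strictComponents φ) (lieBrackets L) d x = φ ⁅x 0, x 1⁆ := by
  have hS : (Finset.univ.filter fun σ : Equiv.Perm (Fin 2) => IsUnshuffle 2 σ) = {1} := by
    decide
  unfold insertion
  -- The index `1` stands for an inner bracket of arity `2`; the index `0` would insert the unary
  -- bracket, which is zero. For arity `2` the only unshuffle is the identity, whose sign is `1` in
  -- any degrees.
  rw [Finset.sum_eq_single (1 : Fin 2)]
  · change ∑ σ ∈ Finset.univ.filter (fun σ : Equiv.Perm (Fin 2) => IsUnshuffle 2 σ),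
      koszulSign d σ • φ ⁅x (σ 0), x (σ 1)⁆ = _
    rw [hS]
    simp [koszulSign]
  · intro b _ hb
    refine Finset.sum_eq_zero fun σ _ => ?_
    have hb' : b.val + 1 ≠ 2 := fun h => hb (Fin.ext (by simpa using h))
    rw [lieBrackets_of_ne hb']
    convert smul_zero _
    exact MultilinearMap.map_coord_zero _ 0 (by simp)
  · simp

/-- Only the composition `1 + 1` survives, since the other one, of length one, meets the zero unary
bracket. Both permutations of two arguments then contribute: in degree one the transposition has
sign `-1`, which the antisymmetry of the bracket cancels, so the two equal terms absorb the factor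
`1/2!`. -/
theorem sum_lieBrackets_strictComponents {V : Type*} [AddCommGroup V] [Module ℝ V]
    (φ : V →ₗ[ℝ] L') {d : Fin 2 → ℤ} (hd : ∀ i, d i = 1) (x : Fin 2 → V) :
    (∑ c : Composition 2, ∑ σ : Equiv.Perm (Fin 2) with IsBlockUnshuffle c σ,
      ((c.length.factorial : ℝ)⁻¹) • koszulSign d σ •
        lieBrackets L' c.length fun a => strictComponents φ (c.blocksFun a)
          fun b => x (σ (c.embedding a b))) = ⁅φ (x 0), φ (x 1)⁆ := by
  have hunit : ∀ a, (Composition.ones 2).blocksFun a = 1 := fun a =>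
    Composition.ones_blocksFun 2 a
  have hlen : (Composition.ones 2).length = 2 := Composition.ones_length 2
  rw [Finset.sum_eq_single (Composition.ones 2)]
  · rw [Finset.filter_true_of_mem]
    · have hU : (Finset.univ : Finset (Equiv.Perm (Fin 2))) = {1, Equiv.swap 0 1} := by decide
      have hterm : ∀ σ : Equiv.Perm (Fin 2), lieBrackets L' (Composition.ones 2).length
          (fun a => strictComponents φ ((Composition.ones 2).blocksFun a)
            fun b => x (σ ((Composition.ones 2).embedding a b))) =
          ⁅φ (x (σ 0)), φ (x (σ 1))⁆ := by
        intro σ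
        refine (lieBrackets_apply hlen _).trans ?_
        rw [strictComponents_apply _ (hunit _), strictComponents_apply _ (hunit _),
          Composition.ones_embedding, Composition.ones_embedding]
        rfl
      simp only [hterm]
      rw [hU, Finset.sum_pair (by decide), hlen]
      have h1 : koszulSign d 1 = 1 := by rw [koszulSign_of_one hd]; decide
      have h2 : koszulSign d (Equiv.swap 0 1) = -1 := by rw [koszulSign_of_one hd]; decide
      rw [h1, h2]
      simp only [Equiv.Perm.coe_one, id_eq, Equiv.swap_apply_left, Equiv.swap_apply_right,
        one_smul, neg_smul]
      rw [lie_skew, ← two_smul ℝ, ← mul_smul]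
      norm_num
    -- Blocks of size one contain no two distinct positions, so every permutation is a block
    -- unshuffle.
    · intro σ _ a b b' hbb'
      have := hunit a
      omega
  · intro c _ hc
    have hc' : c.length ≠ 2 := fun h => hc (Composition.eq_ones_iff_length.2 h)
    refine Finset.sum_eq_zero fun σ _ => ?_
    rw [lieBrackets_of_ne hc']
    simp
  · simp

/-- Turns multilinearity in the single slot of the unary component, phrased with `Function.update`,
into ordinary linearity. -/
theorem update_vecSingle {V : Type*} (x y : V) : Function.update ![x] 0 y = ![y] := by
  ext i
  rw [Subsingleton.elim i 0]
  simp

namespace LInftyMorphism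

variable (F : LInftyMorphism (LInftyAlgebra.ofLie L) (LInftyAlgebra.ofLie L'))

/-- The linear component of an `L_∞`-morphism of Lie algebras. -/
def linearPart : L →ₗ[ℝ] L' where
  toFun x := F.f 1 ![x]
  map_add' x y := by
    simpa only [update_vecSingle] using
      (F.f 1).map_update_add ![0] 0 x y
  map_smul' c x := by
    simpa only [update_vecSingle, RingHom.id_apply] using
      (F.f 1).map_update_smul ![0] 0 c x

/-- For degree reasons, an `L_∞`-morphism of Lie algebras has only its linear component. -/
theorem f_eq_strictComponents : F.f = strictComponents F.linearPart := by
  funext n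
  ext x
  by_cases hn : n = 1
  · subst hn
    change F.f 1 x = F.f 1 ![x 0]
    congr 1
    ext i
    rw [Subsingleton.elim i 0]
    rfl
  · rw [strictComponents_of_ne _ hn]
    -- With all `n` arguments in degree one, the value lies in degree `n`, where the target vanishes
    -- since `n ≠ 1`; this includes `n = 0`.
    refine eq_zero_of_mem_degreeOne (F.f_degree n (fun _ => 1) x fun i => ?_) (by simpa using hn)
    simp [LInftyAlgebra.ofLie, degreeOne]

/-- This is the compatibility equation for two arguments of degree one, once the components other
than the linear one have been removed. -/
theorem linearPart_lie (x y : L) : F.linearPart ⁅x, y⁆ = ⁅F.linearPart x, F.linearPart y⁆ := by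
  have h := F.compat 2 (fun _ => 1) ![x, y] fun i => by simp [LInftyAlgebra.ofLie, degreeOne]
  rw [F.f_eq_strictComponents] at h
  exact (insertion_strictComponents_lieBrackets _ _ _).symm.trans
    (h.trans (sum_lieBrackets_strictComponents _ (fun _ => rfl) _))

/-- The morphism of Lie algebras underlying an `L_∞`-morphism of Lie algebras. -/
def toLieHom : L →ₗ⁅ℝ⁆ L' where
  toLinearMap := F.linearPart
  map_lie' := F.linearPart_lie _ _

variable (L L') in
/-- Morphisms of Lie algebras are the same as `L_∞`-morphisms between them. -/
def lieHomEquiv :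
    (L →ₗ⁅ℝ⁆ L') ≃ LInftyMorphism (LInftyAlgebra.ofLie L) (LInftyAlgebra.ofLie L') where
  toFun := ofLieHom rfl
  invFun := toLieHom
  left_inv _ := rfl
  right_inv F := LInftyMorphism.ext F.f_eq_strictComponents.symm

end LInftyMorphism

end LInfty

/-! ### Co-momentum maps as lifts of the action to Hamiltonian pairs -/

section Momentum

variable {E : Type*} [NormedAddCommGroup E] [NormedSpace ℝ E] [FiniteDimensional ℝ E]
  {M : Type*} [TopologicalSpace M] [ChartedSpace E M] [IsManifold 𝓘(ℝ, E) (⊤ : ℕ∞) M]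
  [T2Space M] {g : Type*} [LieRing g] [LieAlgebra ℝ g]
  (ω : PreSymplecticForm E M) (ρ : g →ₗ⁅ℝ⁆ ω.symplecticVFields)

variable {ω ρ} in
@[ext]
theorem CoMomentumMap.ext {μ ν : CoMomentumMap ω ρ}
    (h : ∀ x, (μ.μ x : SmoothFn E M) = ν.μ x) : μ = ν := by
  obtain ⟨μ, _⟩ := μ
  obtain ⟨ν, _⟩ := ν
  congr 1
  ext x : 2
  exact h x

/-- Linear maps generating the action which map the Lie bracket to the contraction of `ω` are
co-momentum maps. -/
def CoMomentumMap.ofLinearMap (μ : g →ₗ[ℝ] SmoothFn E M)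
    (hμ : ∀ x, ω.IsHamiltonian (ρ x) (μ x))
    (hlie : ∀ x y, μ ⁅x, y⁆ = ω.eval (ρ y) (ρ x)) : CoMomentumMap ω ρ where
  μ :=
    { toLinearMap := μ.codRestrict ω.hamFunctions fun x => ⟨_, hμ x⟩
      map_lie' := by
        intro x y
        ext1
        -- The Poisson bracket is defined through chosen Hamiltonian vector fields, but
        -- `hamFunctions_lie` permits replacing them by `ρ x` and `ρ y`.
        exact (hlie x y).trans
          (PreSymplecticForm.hamFunctions_lie (f := ⟨μ x, _, hμ x⟩) (g := ⟨μ y, _, hμ y⟩)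
            (hμ x) (hμ y)).symm }
  generating := hμ

variable {ω ρ} in
-- The morphism property with the Poisson bracket evaluated on the generators `ρ x`, `ρ y` of the
-- action. In this form it matches the bracket of pairs and the degree-zero part of the homotopy
-- equation.
theorem CoMomentumMap.coe_lie (μ : CoMomentumMap ω ρ) (x y : g) :
    (μ.μ ⁅x, y⁆ : SmoothFn E M) = ω.eval (ρ y) (ρ x) := by
  rw [LieHom.map_lie]
  exact PreSymplecticForm.hamFunctions_lie (μ.generating x) (μ.generating y)

/-- Co-momentum maps are the same as lifts of the action to a morphism of Lie algebras to the
Hamiltonian pairs. -/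
def coMomentumEquivLift :
    CoMomentumMap ω ρ ≃
      {ψ : g →ₗ⁅ℝ⁆ ω.hamPairs // ∀ x, (ψ x).1.1 = (ρ x : VField E M)} where
  toFun μ :=
    ⟨{  toFun := fun x => ⟨((ρ x : VField E M), (μ.μ x : SmoothFn E M)), μ.generating x⟩
        map_add' := fun x y => by
          ext1
          exact Prod.ext (by simp) (by simp)
        map_smul' := fun c x => by
          ext1
          exact Prod.ext (by simp) (by simp)
        map_lie' := fun {x y} => by
          ext1
          refine Prod.ext ?_ (μ.coe_lie x y)
          exact congrArg Subtype.val (ρ.map_lie x y) }, fun _ => rfl⟩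
  invFun ψ := CoMomentumMap.ofLinearMap ω ρ
    (LinearMap.snd ℝ _ _ ∘ₗ ω.hamPairs.subtype ∘ₗ (ψ.1 : g →ₗ[ℝ] ω.hamPairs))
    (fun x => by
      rw [← ψ.2 x]
      exact (ψ.1 x).2)
    (fun x y => by
      rw [← ψ.2 x, ← ψ.2 y]
      -- The function component of the bracket of pairs is by definition the contraction of `ω` with
      -- the two vector fields.
      exact congrArg (fun P : ω.hamPairs => P.1.2) (ψ.1.map_lie x y))
  left_inv _ := rfl
  right_inv ψ := by
    ext x : 3
    -- The vector field component carries no information: the lifting condition forces it to be `ρ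
    -- x`.
    exact Prod.ext (ψ.2 x).symm rfl

/-! ### `L_∞`-momentum maps, ordinary and strong -/

/-- A morphism to the Hamiltonian pairs lifts the action if and only if it does so as an
`L_∞`-morphism. -/
theorem forall_lift_iff (h : LInftyMorphism (LInftyAlgebra.ofLie g) (hamPairsLInfty ω)) :
    (∀ (n : ℕ) (x : Fin n → g), (h.f n x).1.1 = (lInftyAction ω ρ).f n x) ↔
      ∀ x, (h.toLieHom x).1.1 = (ρ x : VField E M) := by
  refine ⟨fun H x => H 1 ![x], fun H n x => ?_⟩
  rw [h.f_eq_strictComponents]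
  by_cases hn : n = 1
  · subst hn
    exact H (x 0)
  -- In every arity other than one, both the lift and the action are zero, so the condition is
  -- automatic.
  · change _ = strictComponents _ n x
    rw [strictComponents_of_ne _ hn, strictComponents_of_ne _ hn]
    rfl

/-- Lifts of the action to the Hamiltonian pairs are the same as `L_∞`-momentum maps. -/
def liftEquivLInftyMomentumMap :
    {ψ : g →ₗ⁅ℝ⁆ ω.hamPairs // ∀ x, (ψ x).1.1 = (ρ x : VField E M)} ≃
      LInftyMomentumMap ω ρ where
  toFun ψ := ⟨LInftyMorphism.lieHomEquiv _ _ ψ.1, (forall_lift_iff ω ρ _).2 ψ.2⟩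
  invFun h := ⟨h.h.toLieHom, (forall_lift_iff ω ρ _).1 h.lift⟩
  left_inv _ := rfl
  right_inv h := by
    obtain ⟨h, _⟩ := h
    simp only [LInftyMomentumMap.mk.injEq]
    exact (LInftyMorphism.lieHomEquiv _ _).apply_symm_apply h

/-- Both actions are built by `LInftyMorphism.ofLieHom` from the same morphism. The equality of the
two `L_∞`-structures on vector fields is used only in the proofs of the axioms, never in the
components, so no transport appears. -/
theorem strongAction_f : (strongAction ω ρ).f = (lInftyAction ω ρ).f := rfl

/-- `L_∞`-momentum maps are the same as strong `L_∞`-momentum maps. -/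
def lInftyEquivStrong : LInftyMomentumMap ω ρ ≃ StrongLInftyMomentumMap ω ρ where
  toFun h := ⟨h.h, fun n x => (h.lift n x).trans (by rw [strongAction_f])⟩
  invFun h := ⟨h.h, fun n x => (h.lift n x).trans (by rw [strongAction_f])⟩
  left_inv _ := rfl
  right_inv _ := rfl

/-! ### Homotopy momentum maps -/

namespace HomotopyMomentumMap

variable {ω ρ}
variable (h : HomotopyMomentumMap ω ρ)

theorem h_zero_snd (x : g) : (h.h (0, x)).2 = 0 :=
  mem_twoTerm_zero.1 (h.h_degree 1 (0, x) (mem_twoTerm_one.2 rfl))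

/-- The target of `Λ² g` under a map of degree `-1` is the component of degree `-1`, which is zero.
-/
theorem h_of_zero (v : ⋀[ℝ]^2 g) : h.h (v, 0) = 0 :=
  (mem_twoTerm_of_ne (by decide) (by decide)).1
    (h.h_degree 0 (v, 0) (mem_twoTerm_zero.2 rfl))

/-- A homotopy is thus determined by the functions it assigns to elements of `g`; this is what makes
the passage to linear maps `g → C^∞(M)` injective. -/
theorem h_eq (v : ⋀[ℝ]^2 g × g) : h.h v = ((h.h (0, v.2)).1, 0) := by
  have hv : v = (v.1, 0) + (0, v.2) := by simp
  conv_lhs => rw [hv, map_add, h.h_of_zero, zero_add]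
  exact Prod.ext rfl (h.h_zero_snd v.2)

/-- The one-form component of the homotopy equation on `g`: as `h` takes values in functions, only
the term `d ∘ h` contributes. -/
theorem isHamiltonian (x : g) : ω.IsHamiltonian (ρ x) (h.h (0, x)).1 := by
  have := congrArg Prod.snd (h.eq (0, x))
  rw [h.h_eq] at this
  refine Eq.trans ?_ (this.trans (by simp))
  rfl

/-- The function component of the homotopy equation at `x ∧ y`: the image of `d` consists of
one-forms, so only `h (e (x ∧ y))` contributes. -/
theorem lie (x y : g) : (h.h (0, ⁅x, y⁆)).1 = ω.eval (ρ y) (ρ x) := by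
  have := congrArg Prod.fst (h.eq (exteriorPower.ιMulti ℝ 2 ![x, y], 0))
  have hl : ((contraction ω).comp (ceMap ρ)).toLinearMap
      (exteriorPower.ιMulti ℝ 2 ![x, y], 0) = (ω.eval (ρ y) (ρ x), 0) := by
    simp [CochainMap.comp, contraction, ceMap, CochainMap.ofSquare,
      exteriorPower.map_apply_ιMulti]
  rw [hl] at this
  simpa using this.symm

end HomotopyMomentumMap

variable {ω ρ} in
/-- The null-homotopy given by a co-momentum map. -/
def CoMomentumMap.toHomotopy (μ : CoMomentumMap ω ρ) : HomotopyMomentumMap ω ρ where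
  h := LinearMap.inl ℝ _ _ ∘ₗ ω.hamFunctions.subtype ∘ₗ (μ.μ : g →ₗ[ℝ] ω.hamFunctions) ∘ₗ
    LinearMap.snd ℝ _ _
  h_degree k v hv := by
    change v ∈ twoTerm _ _ k at hv
    change _ ∈ twoTerm _ _ (k - 1)
    by_cases hk : k = 1
    · subst hk
      exact mem_twoTerm_zero.2 rfl
    -- Outside degree one a homogeneous element has no component in `g`, which is all that the map
    -- sees.
    · have hv2 : v.2 = 0 := by
        by_cases h0 : k = 0
        · subst h0
          exact mem_twoTerm_zero.1 hv
        · rw [(mem_twoTerm_of_ne h0 hk).1 hv]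
          rfl
      convert (twoTerm (SmoothFn E M) (OneForm E M) (k - 1)).zero_mem
      simp [hv2]
  eq v := by
    refine Prod.ext ?_ ?_
    -- Both sides are linear on `Λ² g`, so it suffices to compare them on decomposable elements,
    -- where the identity is the morphism property of `μ`.
    · have : contractTwo ω ∘ₗ exteriorPower.map 2 (ρ : g →ₗ[ℝ] ω.symplecticVFields) =
          ω.hamFunctions.subtype ∘ₗ (μ.μ : g →ₗ[ℝ] ω.hamFunctions) ∘ₗ ceDifferential g := by
        apply exteriorPower.linearMap_ext
        ext w : 1
        simp only [LinearMap.compAlternatingMap_apply, LinearMap.comp_apply,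
          exteriorPower.map_apply_ιMulti, contractTwo_ιMulti, ceDifferential_ιMulti]
        exact (μ.coe_lie (w 0) (w 1)).symm
      simpa [CochainMap.comp, contraction, ceMap, CochainMap.ofSquare] using
        LinearMap.congr_fun this v.1
    · refine (μ.generating v.2).trans ?_
      simp

/-- Co-momentum maps are the same as homotopy momentum maps. -/
def coMomentumEquivHomotopy : CoMomentumMap ω ρ ≃ HomotopyMomentumMap ω ρ where
  toFun := CoMomentumMap.toHomotopy
  invFun h := CoMomentumMap.ofLinearMap ω ρ
    (LinearMap.fst ℝ _ _ ∘ₗ h.h ∘ₗ LinearMap.inr ℝ _ _)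
    (HomotopyMomentumMap.isHamiltonian h) (HomotopyMomentumMap.lie h)
  left_inv _ := rfl
  right_inv h := CochainNullHomotopy.ext <| LinearMap.ext fun v =>
    (HomotopyMomentumMap.h_eq h v).symm

/-- Since the unary bracket of a Lie algebra vanishes, every homotopy momentum map is
Hamiltonian. -/
def homotopyEquivHamiltonian :
    HomotopyMomentumMap ω ρ ≃ HomotopyHamiltonianMomentumMap ω ρ where
  -- The element `(0, l_1 x)` is definitionally zero.
  toFun h := ⟨h, fun _ => h.h.map_zero⟩
  invFun h := h.toHomotopy
  left_inv _ := rfl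
  right_inv _ := rfl

end Momentum

end MomentumMaps

end

/-! ### Assembly of the bijections -/

theorem proposition5p2
    {E : Type*} [NormedAddCommGroup E] [NormedSpace ℝ E] [FiniteDimensional ℝ E]
    {M : Type*} [TopologicalSpace M] [ChartedSpace E M] [IsManifold 𝓘(ℝ, E) (⊤ : ℕ∞) M] [T2Space M]
    {g : Type*} [LieRing g] [LieAlgebra ℝ g]
    (ω : PreSymplecticForm E M) (ρ : g →ₗ⁅ℝ⁆ ω.symplecticVFields) :
    ∃ (e₂ : CoMomentumMap ω ρ ≃ LInftyMomentumMap ω ρ)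
      (e₃ : CoMomentumMap ω ρ ≃ StrongLInftyMomentumMap ω ρ)
      (e₄ : CoMomentumMap ω ρ ≃ HomotopyMomentumMap ω ρ)
      (e₅ : CoMomentumMap ω ρ ≃ HomotopyHamiltonianMomentumMap ω ρ),
      ∀ (μ : CoMomentumMap ω ρ) (x : g),
        ((e₂ μ).h.f 1 ![x]).1 = ((ρ x : VField E M), (μ.μ x : SmoothFn E M)) ∧
        ((e₃ μ).h.f 1 ![x]).1 = ((ρ x : VField E M), (μ.μ x : SmoothFn E M)) ∧
        (e₄ μ).h (0, x) = ((μ.μ x : SmoothFn E M), 0) ∧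
        (e₅ μ).toHomotopy.h (0, x) = ((μ.μ x : SmoothFn E M), 0) := by
  refine ⟨(coMomentumEquivLift ω ρ).trans (liftEquivLInftyMomentumMap ω ρ),
    (coMomentumEquivLift ω ρ).trans
      ((liftEquivLInftyMomentumMap ω ρ).trans (lInftyEquivStrong ω ρ)),
    coMomentumEquivHomotopy ω ρ,
    (coMomentumEquivHomotopy ω ρ).trans (homotopyEquivHamiltonian ω ρ),
    -- The forward directions are given by explicit formulas in `ρ` and `μ`, so the prescribed
    -- values hold by computation.
    fun μ x => ⟨rfl, rfl, rfl, rfl⟩⟩
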